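/- Let $(X,\mathcal B,\mu)$ be a standard, non-atomic probability space, and let $\mathcal T$ be the group of invertible measure-preserving maps of $(X,\mathcal B,\mu)$ with the weak topology, i.e. the topology generated by the sets $\{S\in\mathcal T:\mu(S^{-1}A\,\triangle\, T^{-1}A)<\varepsilon\}$ with $T\in\mathcal T$, $A\in\mathcal B$ and $\varepsilon>0$. For $T\in\mathcal T$, $v\in\mathbb Z$, $L\in\mathbb Z^+$ and a (real- or complex-valued) function $f$ write \[ M(v,L)^Tf=\frac1L\sum_{k=v+1}^{v+L} f\circ T^k . \] Fix a strictly increasing sequence $(L_n)_{n\ge1}$ in $\mathbb Z^+$ and a function $f\in L^1(\mu)$ with $\int_X f\,d\mu=0$ that is not a.e. equal to $0$. Then there are $\delta>0$ and a dense $G_\delta$ subset $\mathcal G$ of $\mathcal T$ such that every $T\in\mathcal G$ is ergodic and satisfies: 1. $\displaystyle\sum_{n=1}^\infty \mu\{|M(0,L_n)^Tf|\ge\delta\}=\infty$; 2. there is a sequence $(v_n)$ in $\mathbb Z$ (which may depend on $T$) such that \[ \limsup_{n\to\infty}|M(v_n,L_n)^Tf|\ge\delta\ \text{ a.e.}\qquad\text{and}\qquad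 \liminf_{n\to\infty}|M(v_n,L_n)^Tf|=0\ \text{ a.e.} \] In particular, for a.e. $x$ the sequence $(M(v_n,L_n)^Tf(x))_{n\ge1}$ does not converge. -/

import Mathlib

open MeasureTheory Filter Topology Set
open scoped ENNReal symmDiff

/-- The invertible measure-preserving maps of `(X, μ)`. Maps which agree almost everywhere are not
identified, but they are topologically indistinguishable for the weak topology below. -/
def MPMap {X : Type*} [MeasurableSpace X] (μ : Measure X) : Type _ :=
  {T : X ≃ᵐ X // MeasurePreserving T μ μ}

namespace MPMap

variable {X : Type*} [MeasurableSpace X] {μ : Measure X}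

instance : CoeFun (MPMap μ) (fun _ => X → X) := ⟨fun T => T.1⟩

/-- The weak topology, generated by the sets `{S | μ (S⁻¹ A ∆ T⁻¹ A) < ε}` with `A` measurable.
Since `μ (S⁻¹ A ∆ T⁻¹ A) = μ (S B ∆ T B)` for `B = T⁻¹ A`, and since `T` is a bijection on
measurable sets, the generating family is the same as the one written with direct images. -/
instance weakTopology : TopologicalSpace (MPMap μ) :=
  TopologicalSpace.generateFrom
    {U | ∃ (T : MPMap μ) (A : Set X) (ε : ℝ≥0∞), MeasurableSet A ∧
      U = {S : MPMap μ | μ ((S ⁻¹' A) ∆ (T ⁻¹' A)) < ε}}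

/-- The integer power `T ^ k`, as a map from `X` to `X`. -/
def iter (T : MPMap μ) (k : ℤ) : X → X :=
  ((T.1.toEquiv : Equiv.Perm X) ^ k : Equiv.Perm X)

/-- The moving average `M(v, L)^T f = (1 / L) ∑_{k = v + 1}^{v + L} f ∘ T ^ k`. -/
noncomputable def movingAverage {𝕜 : Type*} [RCLike 𝕜] (T : MPMap μ) (v : ℤ) (L : ℕ)
    (f : X → 𝕜) (x : X) : 𝕜 :=
  (1 / (L : 𝕜)) * ∑ k ∈ Finset.Icc (v + 1) (v + (L : ℤ)), f (T.iter k x)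

end MPMap

/-! The proof is a Baire category argument. Sending `T` to `(j ∘ T, j ∘ T⁻¹)`, for a bounded Borel
embedding `j` of `X` into the line, identifies the weak topology with that of a closed subset of `L¹
× L¹`. Hence `MPMap μ` is completely pseudometrizable and countable intersections of dense open sets
are dense.

Two properties are generic. (a) Choose `δ` so that `{‖f‖ > δ}` has positive measure. Maps fixing
pointwise a non-null part `E` of this set are dense (`dense_setOf_exists_fixed`); for them every
ergodic average equals `f` on `E`, so the measures of the sets where the averages exceed `δ` have
infinite sum. Exceeding a given partial bound is an open condition by lower semicontinuity. (b) The
averages of every centred integrable function tend to zero in `L¹`. One small average suffices for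
this, which is an open condition. Density (`dense_setOf_exists_birkhoffAverage_close`) comes from a
skew product on `ZMod (n * m) × Xⁿ` that runs `T` for `m` steps on each coordinate in turn: reading
the active coordinate gives nearly `T`, while averages over a period are means of `n` independent
variables. Such models are carried back to `X` by an isomorphism respecting finitely many sets
(`exists_conj_close`).

If `T` has both properties, (b) gives ergodicity and allows the sets from (a) to be shifted, one
after another, so that each covers its fair share, up to a factor 2, of what is still uncovered.
Thus almost every point is covered infinitely often (`exists_iterates_frequently_mem`), which gives
the limsup. Shifting does not change `L¹` norms, so the shifted averages still tend to zero in `L¹`,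
and Fatou's lemma gives the liminf. -/

/-! ### Correcting almost everywhere invertible maps to Borel isomorphisms -/

section AEInverse

variable {X Y : Type*} [MeasurableSpace X] [StandardBorelSpace X] [MeasurableSpace Y]
  [StandardBorelSpace Y]

/-- A set of positive measure contains an uncountable Borel null set. -/
theorem exists_uncountable_null_subset (μ : Measure X) [IsFiniteMeasure μ]
    [NullSingletonClass μ] {A : Set X} (hA : MeasurableSet A) (hμA : μ A ≠ 0) :
    ∃ N ⊆ A, MeasurableSet N ∧ μ N = 0 ∧ ¬ N.Countable := by
  have hAc : ¬ Countable A := fun h => hμA (Set.Countable.measure_zero (countable_coe_iff.1 h) μ)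
  have : StandardBorelSpace A := hA.standardBorel
  have hR : ¬ Countable (ℝ × ℝ) := fun h =>
    not_countable (α := ℝ) (Function.Injective.countable (f := fun t : ℝ => (t, t))
      fun a b h => (Prod.ext_iff.1 h).1)
  -- The plane is a disjoint union of uncountably many uncountable lines, of which only countably
  -- many can carry positive measure.
  let e : A ≃ᵐ ℝ × ℝ := PolishSpace.measurableEquivOfNotCountable hAc hR
  let N : ℝ → Set X := fun t => Subtype.val '' (e ⁻¹' ({t} ×ˢ univ))
  have hN : ∀ t, MeasurableSet (N t) := fun t =>
    hA.subtype_image (e.measurable ((measurableSet_singleton t).prod MeasurableSet.univ))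
  have hd : Pairwise (Function.onFun Disjoint N) := by
    intro s t hst
    refine Set.disjoint_left.2 ?_
    rintro _ ⟨x, hx, rfl⟩ ⟨y, hy, hxy⟩
    obtain rfl := Subtype.ext hxy
    simp only [mem_preimage, mem_prod, mem_singleton_iff, mem_univ, and_true] at hx hy
    exact hst (hx.symm.trans hy)
  have hc := Measure.countable_meas_pos_of_disjoint_iUnion (μ := μ) hN hd
  obtain ⟨t, ht⟩ : ∃ t, μ (N t) = 0 := by
    by_contra! h
    refine not_countable (α := ℝ) (countable_univ_iff.1 (hc.mono fun t _ => ?_))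
    exact pos_iff_ne_zero.2 (h t)
  refine ⟨N t, ?_, hN t, ht, fun hcount => ?_⟩
  · rintro _ ⟨x, -, rfl⟩
    exact x.2
  · have : Countable (N t) := hcount.to_subtype
    refine not_countable (α := ℝ) (Function.Injective.countable
      (f := fun s : ℝ => (⟨e.symm (t, s), e.symm (t, s), by simp, rfl⟩ : N t)) fun a b h => ?_)
    have h1 : (e.symm (t, a) : X) = e.symm (t, b) := congrArg (fun z : N t => z.1) h
    exact (Prod.ext_iff.1 (e.symm.injective (Subtype.ext h1))).2

/-- A measure-preserving map with an almost everywhere left inverse agrees almost everywhere with a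
measurable equivalence. -/
theorem MeasureTheory.MeasurePreserving.exists_measurableEquiv_ae_eq {μ : Measure X} {ν : Measure Y}
    [IsProbabilityMeasure μ] [NullSingletonClass μ] {T : X → Y} {S : Y → X}
    (hT : MeasurePreserving T μ ν) (hS : Measurable S) (hST : ∀ᵐ x ∂μ, S (T x) = x) :
    ∃ e : X ≃ᵐ Y, MeasurePreserving e μ ν ∧ e =ᵐ[μ] T := by
  classical
  have hA : MeasurableSet {x | S (T x) = x} :=
    measurableSet_eq_fun (hS.comp hT.measurable) measurable_id
  have hA1 : μ {x | S (T x) = x} = 1 := by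
    rw [(prob_compl_eq_zero_iff hA).symm]
    exact hST
  -- Removing an uncountable null set `N` from the domain leaves uncountable complements on both
  -- sides (`S` maps `Bᶜ` onto a set containing `N`), so the exceptional sets are Borel isomorphic
  -- and the map can be completed to a bijection.
  obtain ⟨N, hNA, hN, hN0, hNc⟩ := exists_uncountable_null_subset μ hA (by simp [hA1])
  set A : Set X := {x | S (T x) = x} \ N with hAdef
  have hAm : MeasurableSet A := hA.diff hN
  have hAae : ∀ᵐ x ∂μ, x ∈ A := by
    have : ∀ᵐ x ∂μ, x ∉ N := measure_eq_zero_iff_ae_notMem.1 hN0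
    filter_upwards [hST, this] with x h1 h2 using ⟨h1, h2⟩
  set B : Set Y := {y | T (S y) = y ∧ S y ∈ A} with hBdef
  have hBm : MeasurableSet B :=
    (measurableSet_eq_fun (hT.measurable.comp hS) measurable_id).inter (hS hAm)
  have hTA : ∀ x ∈ A, T x ∈ B := fun x hx => by
    have h : S (T x) = x := hx.1
    exact ⟨by rw [h], by rwa [h]⟩
  let e1 : A ≃ᵐ B :=
    { toFun := fun x => ⟨T x, hTA x x.2⟩
      invFun := fun y => ⟨S y, y.2.2⟩
      left_inv := fun x => Subtype.ext x.2.1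
      right_inv := fun y => Subtype.ext y.2.1
      measurable_toFun := (hT.measurable.comp measurable_subtype_coe).subtype_mk
      measurable_invFun := (hS.comp measurable_subtype_coe).subtype_mk }
  have hAc : ¬ Countable (Aᶜ : Set X) := fun h =>
    hNc (Set.Countable.mono (s₂ := Aᶜ) (fun x hx hxA => hxA.2 hx) (countable_coe_iff.1 h))
  have hBc : ¬ Countable (Bᶜ : Set Y) := fun h => by
    refine hNc (((countable_coe_iff.1 h).image S).mono fun x hx => ?_)
    have hxx : S (T x) = x := hNA hx
    refine ⟨T x, fun hB => ?_, hxx⟩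
    have := hB.2
    rw [hxx] at this
    exact this.2 hx
  have := hAm.compl.standardBorel
  have := hBm.compl.standardBorel
  let e2 : (Aᶜ : Set X) ≃ᵐ (Bᶜ : Set Y) := PolishSpace.measurableEquivOfNotCountable hAc hBc
  let e : X ≃ᵐ Y := (MeasurableEquiv.sumCompl hAm).symm.trans
    ((MeasurableEquiv.sumCongr e1 e2).trans (MeasurableEquiv.sumCompl hBm))
  have heT : e =ᵐ[μ] T := by
    filter_upwards [hAae] with x hx
    change (MeasurableEquiv.sumCompl hBm) ((MeasurableEquiv.sumCongr e1 e2)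
      ((Equiv.Set.sumCompl A).symm x)) = T x
    rw [Equiv.Set.sumCompl_symm_apply_of_mem hx]
    rfl
  exact ⟨e, ⟨e.measurable, by rw [Measure.map_congr heT, hT.map_eq]⟩, heT⟩

end AEInverse

/-! ### Isomorphism of atomless standard probability spaces, respecting partitions -/

section Uniformization

open ProbabilityTheory

theorem ProbabilityTheory.continuous_cdf (m : Measure ℝ) [IsProbabilityMeasure m]
    [NullSingletonClass m] : Continuous (cdf m) := by
  refine continuous_iff_continuousAt.2 fun x => ?_
  rw [(monotone_cdf m).continuousAt_iff_leftLim_eq_rightLim, (cdf m).rightLim_eq]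
  have h : (cdf m).measure {x} = 0 := by rw [measure_cdf]; exact measure_singleton x
  rw [StieltjesFunction.measure_singleton, ENNReal.ofReal_eq_zero] at h
  have := (monotone_cdf m).leftLim_le (le_refl x)
  linarith

theorem ProbabilityTheory.exists_cdf_eq (m : Measure ℝ) [IsProbabilityMeasure m]
    [NullSingletonClass m] {t : ℝ} (h0 : 0 < t) (h1 : t < 1) : ∃ s, cdf m s = t := by
  obtain ⟨a, ha⟩ := ((tendsto_cdf_atBot m).eventually_lt_const h0).exists
  obtain ⟨b, hb⟩ := ((tendsto_cdf_atTop m).eventually_const_lt h1).exists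
  exact mem_range_of_exists_le_of_exists_ge (continuous_cdf m) ⟨a, ha.le⟩ ⟨b, hb.le⟩

/-- The distribution function of an atomless law is uniformly distributed. -/
theorem ProbabilityTheory.map_cdf (m : Measure ℝ) [IsProbabilityMeasure m]
    [NullSingletonClass m] : m.map (cdf m) = volume.restrict (Icc 0 1) := by
  have hF := continuous_cdf m
  have : IsProbabilityMeasure (m.map (cdf m)) :=
    Measure.isProbabilityMeasure_map hF.measurable.aemeasurable
  refine Measure.ext_of_Iic _ _ fun t => ?_
  rw [Measure.map_apply hF.measurable measurableSet_Iic, Measure.restrict_apply measurableSet_Iic]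
  rcases lt_or_ge t 0 with ht | ht
  · have h1 : cdf m ⁻¹' Iic t = ∅ := by
      ext x
      simpa using ht.trans_le (cdf_nonneg m x)
    have h2 : Iic t ∩ Icc (0 : ℝ) 1 = ∅ := by
      ext x
      simp only [mem_inter_iff, mem_Iic, mem_Icc, mem_empty_iff_false, iff_false]
      intro h
      linarith [h.1, h.2.1]
    simp [h1, h2]
  rcases le_or_gt 1 t with ht1 | ht1
  · have h1 : cdf m ⁻¹' Iic t = univ := by
      ext x
      simpa using (cdf_le_one m x).trans ht1
    have h2 : Iic t ∩ Icc (0 : ℝ) 1 = Icc 0 1 :=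
      inter_eq_right.2 fun x hx => hx.2.trans ht1
    simp [h1, h2]
  have h2 : Iic t ∩ Icc (0 : ℝ) 1 = Icc 0 t := by
    ext x
    simp only [mem_inter_iff, mem_Iic, mem_Icc]
    exact ⟨fun h => ⟨h.2.1, h.1⟩, fun h => ⟨h.2, h.1, h.2.trans ht1.le⟩⟩
  rw [h2, Real.volume_Icc, sub_zero]
  apply le_antisymm
  -- The distribution function may have a plateau at height `t`, so `{cdf ≤ t}` is bounded through
  -- an attained level `t'` slightly above `t`.
  · refine ENNReal.le_of_forall_pos_le_add fun ε hε _ => ?_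
    obtain ⟨t', ht', ht'2⟩ := exists_between (lt_min ht1 (lt_add_of_pos_right t hε))
    obtain ⟨s, hs⟩ := exists_cdf_eq m (ht.trans_lt ht') (ht'2.trans_le (min_le_left _ _))
    have hsub : cdf m ⁻¹' Iic t ⊆ Iic s := fun x hx => by
      by_contra hxs
      have h3 := monotone_cdf m (not_le.1 hxs).le
      have h4 : cdf m x ≤ t := hx
      linarith
    calc m (cdf m ⁻¹' Iic t) ≤ m (Iic s) := measure_mono hsub
      _ = ENNReal.ofReal t' := by rw [← ofReal_cdf, hs]
      _ ≤ ENNReal.ofReal (t + ε) :=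
        ENNReal.ofReal_le_ofReal (ht'2.le.trans (min_le_right _ _))
      _ = ENNReal.ofReal t + ε := by
        rw [ENNReal.ofReal_add ht (NNReal.coe_nonneg ε), ENNReal.ofReal_coe_nnreal]
  · rcases ht.eq_or_lt with rfl | ht0
    · simp
    obtain ⟨s, hs⟩ := exists_cdf_eq m ht0 ht1
    rw [← hs, ofReal_cdf]
    exact measure_mono fun x hx => monotone_cdf m hx

variable {X Y : Type*} [MeasurableSpace X] [StandardBorelSpace X] [MeasurableSpace Y]
  [StandardBorelSpace Y]

/-- An injective real function on an atomless probability space gives an isomorphism with the unit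
interval, by way of its distribution function. -/
theorem exists_leftInverse_of_injective (μ : Measure X) [IsProbabilityMeasure μ]
    [NullSingletonClass μ] {ι : X → ℝ} (hι : Measurable ι) (hinj : Function.Injective ι) :
    MeasurePreserving (fun x => μ.real {z | ι z ≤ ι x}) μ (volume.restrict (Icc 0 1)) ∧
    ∃ G : ℝ → X, Measurable G ∧ ∀ᵐ x ∂μ, G (μ.real {z | ι z ≤ ι x}) = x := by
  classical
  have : IsProbabilityMeasure (μ.map ι) := Measure.isProbabilityMeasure_map hι.aemeasurable
  have hna : NullSingletonClass (μ.map ι) := ⟨fun t => by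
    rw [Measure.map_apply hι (measurableSet_singleton t)]
    exact Set.Subsingleton.measure_zero (fun x hx y hy => hinj (hx.trans hy.symm)) μ⟩
  set F : X → ℝ := fun x => μ.real {z | ι z ≤ ι x} with hF
  have hFc : F = cdf (μ.map ι) ∘ ι := by
    funext x
    simp only [hF, Function.comp, cdf_eq_real, Measure.real,
      Measure.map_apply hι measurableSet_Iic]
    rfl
  have hFm : Measurable F := hFc ▸ (continuous_cdf _).measurable.comp hι
  have hFp : MeasurePreserving F μ (volume.restrict (Icc 0 1)) := ⟨hFm, by
    rw [hFc, ← Measure.map_map (continuous_cdf _).measurable hι, map_cdf]⟩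
  refine ⟨hFp, ?_⟩
  set c : ℝ → ℝ := fun t => cdf (μ.map ι) t with hc
  have hFx : ∀ x, F x = c (ι x) := fun x => congrFun hFc x
  -- Two points with the same value of `F` have a rational between their images under `ι`, where `c`
  -- takes that value too. Discarding the countably many values `c q` therefore makes `F` injective.
  have hgood : ∀ᵐ x ∂μ, ∀ q : ℚ, F x ≠ c q := by
    rw [ae_all_iff]
    intro q
    exact hFp.quasiMeasurePreserving.ae
      (Measure.ae_ne (volume.restrict (Icc (0 : ℝ) 1)) (c q))
  have hAm : MeasurableSet {x | ∀ q : ℚ, F x ≠ c q} := by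
    have : {x | ∀ q : ℚ, F x ≠ c q} = ⋂ q : ℚ, (F ⁻¹' {c q})ᶜ := by ext; simp
    rw [this]
    exact MeasurableSet.iInter fun q => (hFm (measurableSet_singleton _)).compl
  set A : Set X := {x | ∀ q : ℚ, F x ≠ c q} with hA
  have hlt : ∀ x ∈ A, ∀ y ∈ A, ι x < ι y → F x < F y := fun x hx y hy hxy => by
    obtain ⟨q, h1, h2⟩ := exists_rat_btwn hxy
    have h3 : F x ≤ c q := (hFx x).le.trans (monotone_cdf _ h1.le)
    have h4 : c q ≤ F y := (monotone_cdf _ h2.le).trans (hFx y).ge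
    exact (lt_of_le_of_ne h3 (hx q)).trans_le h4
  have hFinj : Function.Injective (A.domRestrict F) := fun x y hxy => by
    have hxy' : F x = F y := hxy
    rcases lt_trichotomy (ι x) (ι y) with h | h | h
    · exact absurd hxy' (hlt x x.2 y y.2 h).ne
    · exact Subtype.ext (hinj h)
    · exact absurd hxy' (hlt y y.2 x x.2 h).ne'
  have := hAm.standardBorel
  have hemb : MeasurableEmbedding (A.domRestrict F) :=
    (hFm.comp measurable_subtype_coe).measurableEmbedding hFinj
  have : Nonempty X := by
    by_contra h
    have := not_nonempty_iff.1 h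
    exact IsProbabilityMeasure.ne_zero μ (Measure.eq_zero_of_isEmpty μ)
  obtain ⟨G, hG, hGF⟩ := hemb.exists_measurable_extend measurable_subtype_coe
    fun _ => inferInstance
  refine ⟨G, hG, ?_⟩
  filter_upwards [hgood] with x hx
  exact congrFun hGF ⟨x, hx⟩

/-- Atomless standard probability spaces are isomorphic, by an isomorphism which matches given
countable partitions with equal laws. -/
theorem exists_measurableEquiv_comp_ae_eq {μ : Measure X} {ν : Measure Y}
    [IsProbabilityMeasure μ] [IsProbabilityMeasure ν]
    [NullSingletonClass μ] [NullSingletonClass ν] {q : X → ℕ} {q' : Y → ℕ}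
    (hq : Measurable q) (hq' : Measurable q') (h : μ.map q = ν.map q') :
    ∃ e : X ≃ᵐ Y, MeasurePreserving e μ ν ∧ ∀ᵐ x ∂μ, q' (e x) = q x := by
  -- The integer part of `ι` is the class and the sigmoid orders points within it. The distribution
  -- function thus sends each class to an interval whose endpoints depend only on the law of `q`, so
  -- equal laws give matching intervals.
  let ι : X → ℝ := fun x => q x + Real.sigmoid (embeddingReal X x)
  let κ : Y → ℝ := fun y => q' y + Real.sigmoid (embeddingReal Y y)
  have hcast : Measurable (fun n : ℕ => (n : ℝ)) := measurable_from_nat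
  have hι : Measurable ι := (hcast.comp hq).add
    (_root_.continuous_sigmoid.measurable.comp (measurableEmbedding_embeddingReal X).measurable)
  have hκ : Measurable κ := (hcast.comp hq').add
    (_root_.continuous_sigmoid.measurable.comp (measurableEmbedding_embeddingReal Y).measurable)
  have key : ∀ (a b : ℕ) (s t : ℝ), (a : ℝ) + Real.sigmoid s ≤ b + Real.sigmoid t → a ≤ b := by
    intro a b s t hab
    have h1 := Real.sigmoid_pos s
    have h2 := Real.sigmoid_lt_one t
    have : (a : ℝ) < b + 1 := by linarith
    exact Nat.lt_succ_iff.1 (by exact_mod_cast this)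
  have hιinj : Function.Injective ι := fun x y hxy => by
    have h1 : q x = q y := le_antisymm (key _ _ _ _ hxy.le) (key _ _ _ _ hxy.ge)
    simp only [ι, h1, add_right_inj] at hxy
    exact (measurableEmbedding_embeddingReal X).injective (Real.sigmoid_strictMono.injective hxy)
  have hκinj : Function.Injective κ := fun x y hxy => by
    have h1 : q' x = q' y := le_antisymm (key _ _ _ _ hxy.le) (key _ _ _ _ hxy.ge)
    simp only [κ, h1, add_right_inj] at hxy
    exact (measurableEmbedding_embeddingReal Y).injective (Real.sigmoid_strictMono.injective hxy)
  obtain ⟨hF, G, hG, hGF⟩ := exists_leftInverse_of_injective μ hι hιinj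
  obtain ⟨hF', G', hG', hGF'⟩ := exists_leftInverse_of_injective ν hκ hκinj
  set F : X → ℝ := fun x => μ.real {z | ι z ≤ ι x} with hFdef
  set F' : Y → ℝ := fun x => ν.real {z | κ z ≤ κ x} with hFdef'
  replace hGF : ∀ᵐ x ∂μ, G (F x) = x := hGF
  replace hGF' : ∀ᵐ y ∂ν, G' (F' y) = y := hGF'
  have hG'p : MeasurePreserving G' (volume.restrict (Icc 0 1)) ν := ⟨hG', by
    rw [← hF'.map_eq, Measure.map_map hG' hF'.measurable,
      Measure.map_congr (show G' ∘ F' =ᵐ[ν] id from hGF'), Measure.map_id]⟩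
  have hFG' : ∀ᵐ t ∂(volume.restrict (Icc (0 : ℝ) 1)), F' (G' t) = t := by
    have hm : MeasurableSet {t | F' (G' t) = t} :=
      measurableSet_eq_fun (hF'.measurable.comp hG') measurable_id
    rw [← hF'.map_eq, ae_map_iff hF'.measurable.aemeasurable hm]
    filter_upwards [hGF'] with y hy
    rw [hy]
  have hFT : ∀ᵐ x ∂μ, F' (G' (F x)) = F x := hF.quasiMeasurePreserving.ae hFG'
  obtain ⟨e, he, heT⟩ := (hG'p.comp hF).exists_measurableEquiv_ae_eq (S := G ∘ F')
    (hG.comp hF'.measurable) (by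
      filter_upwards [hFT, hGF] with x h1 h2
      simp only [Function.comp, h1, h2])
  refine ⟨e, he, ?_⟩
  have hlaw : ∀ i : ℕ, μ.real {x | q x ≤ i} = ν.real {y | q' y ≤ i} := fun i => by
    have := congrArg (fun m : Measure ℕ => m.real (Iic i)) h
    simp only [Measure.real, Measure.map_apply hq measurableSet_Iic,
      Measure.map_apply hq' measurableSet_Iic] at this
    exact this
  -- Interval endpoints are discarded: if `x` and `e x` lay in different classes, their common value
  -- `F x` would have to be such an endpoint.
  have hgood : ∀ᵐ x ∂μ, ∀ i : ℕ, F x ≠ μ.real {x | q x ≤ i} := by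
    rw [ae_all_iff]
    intro i
    exact hF.quasiMeasurePreserving.ae (Measure.ae_ne (volume.restrict (Icc (0 : ℝ) 1)) _)
  filter_upwards [heT, hFT, hgood] with x hx1 hx2 hx3
  have hx4 : F' (e x) = F x := by rw [hx1]; exact hx2
  rcases lt_trichotomy (q' (e x)) (q x) with hlt | heq | hlt
  · exfalso
    refine hx3 (q' (e x)) (le_antisymm ?_ ?_)
    · rw [← hx4, hlaw]
      exact measureReal_mono fun z hz => key _ _ _ _ hz
    · refine measureReal_mono fun z hz => ?_
      by_contra hzx
      have : q x ≤ q z := key _ _ _ _ (not_le.1 hzx).le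
      have hz' : q z ≤ q' (e x) := hz
      omega
  · exact heq
  · exfalso
    refine hx3 (q x) (le_antisymm ?_ ?_)
    · exact measureReal_mono fun z hz => key _ _ _ _ hz
    · rw [← hx4, hlaw]
      refine measureReal_mono fun z hz => ?_
      by_contra hzx
      have : q' (e x) ≤ q' z := key _ _ _ _ (not_le.1 hzx).le
      have hz' : q' z ≤ q x := hz
      omega

end Uniformization

/-! ### Control of compositions in `L¹` by a single embedding -/

section Approximation

variable {X Ω E : Type*} [MeasurableSpace X] [MeasurableSpace Ω] [NormedAddCommGroup E]

theorem lintegral_enorm_sub_le {ρ : Measure Ω} {f g h : Ω → E} (hf : AEStronglyMeasurable f ρ)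
    (hg : AEStronglyMeasurable g ρ) :
    ∫⁻ x, ‖f x - h x‖ₑ ∂ρ ≤ ∫⁻ x, ‖f x - g x‖ₑ ∂ρ + ∫⁻ x, ‖g x - h x‖ₑ ∂ρ := by
  have hm : AEMeasurable (fun x => ‖f x - g x‖ₑ) ρ := (hf.sub hg).enorm
  rw [← lintegral_add_left' hm]
  refine lintegral_mono fun x => ?_
  have : f x - h x = (f x - g x) + (g x - h x) := by abel
  rw [this]
  exact enorm_add_le _ _

theorem lintegral_enorm_sub_comm {ρ : Measure Ω} (f g : Ω → E) :
    ∫⁻ x, ‖f x - g x‖ₑ ∂ρ = ∫⁻ x, ‖g x - f x‖ₑ ∂ρ := by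
  simp only [← edist_eq_enorm_sub, edist_comm]

theorem lintegral_enorm_indicator_comp_sub {ρ : Measure Ω} {A : Set X} (hA : MeasurableSet A)
    (c : E) {S T : Ω → X} (hS : Measurable S) (hT : Measurable T) :
    ∫⁻ x, ‖A.indicator (fun _ => c) (S x) - A.indicator (fun _ => c) (T x)‖ₑ ∂ρ =
      ‖c‖ₑ * ρ ((S ⁻¹' A) ∆ (T ⁻¹' A)) := by
  rw [← lintegral_indicator_const ((hS hA).symmDiff (hT hA))]
  refine lintegral_congr fun x => ?_
  by_cases h1 : S x ∈ A <;> by_cases h2 : T x ∈ A <;> simp [h1, h2, Set.mem_symmDiff]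

/-- Along measure-preserving maps, the `L¹` distance of `g ∘ S` and `g ∘ T` is controlled by the
distance of `j ∘ S` and `j ∘ T`, where `j` is a fixed measurable embedding into the line. -/
theorem exists_lintegral_enorm_comp_sub_le [NormedSpace ℝ E] {μ : Measure X}
    [IsProbabilityMeasure μ] {j : X → ℝ} (hj : MeasurableEmbedding j) {g : X → E}
    (hg : Integrable g μ) {ε : NNReal} (hε : 0 < ε) :
    ∃ K : NNReal, ∀ (ρ : Measure Ω) [IsProbabilityMeasure ρ] (S T : Ω → X),
      MeasurePreserving S ρ μ → MeasurePreserving T ρ μ →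
      ∫⁻ x, ‖g (S x) - g (T x)‖ₑ ∂ρ ≤ ε + K * ∫⁻ x, ‖j (S x) - j (T x)‖ₑ ∂ρ := by
  have : IsProbabilityMeasure (μ.map j) :=
    Measure.isProbabilityMeasure_map hj.measurable.aemeasurable
  let H : ℝ → E := Function.extend j g 0
  have hH : ∀ x, H (j x) = g x := fun x => hj.injective.extend_apply g 0 x
  have hHi : Integrable H (μ.map j) := by
    rw [hj.integrable_map_iff]
    exact hg.congr (Eventually.of_forall fun x => (hH x).symm)
  have h3 : 0 < ε / 3 := div_pos hε (by norm_num)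
  -- The approximant `φ` depends only on the law of `j` under `μ`, so the constant built from it
  -- serves all `ρ`, `S` and `T`.
  obtain ⟨φ, hφc, hφ1, hφ, -⟩ := hHi.exists_hasCompactSupport_lintegral_sub_le
    (ε := (ε / 3 : NNReal)) (by simpa using h3.ne')
  rw [hj.lintegral_map] at hφ1
  simp only [hH] at hφ1
  obtain ⟨M, hM⟩ := hφc.exists_bound_of_continuous hφ
  have hM0 : 0 ≤ M := (norm_nonneg _).trans (hM 0)
  obtain ⟨δ, hδ, hδφ⟩ := Metric.uniformContinuous_iff.1
    (hφc.uniformContinuous_of_continuous hφ) (ε / 3 : NNReal) h3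
  -- Arguments closer than `δ` are handled by uniform continuity; otherwise the trivial bound `2 *
  -- M` is at most `K` times their distance.
  let K : NNReal := ⟨2 * M / δ, by positivity⟩
  have hφK : ∀ a b, ‖φ a - φ b‖ₑ ≤ (ε / 3 : NNReal) + K * ‖a - b‖ₑ := by
    intro a b
    rw [← ofReal_norm, ← ofReal_norm, ← ENNReal.ofReal_coe_nnreal,
      ← ENNReal.ofReal_coe_nnreal, ← ENNReal.ofReal_mul (NNReal.coe_nonneg K),
      ← ENNReal.ofReal_add (NNReal.coe_nonneg _) (mul_nonneg (NNReal.coe_nonneg K) (norm_nonneg _))]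
    refine ENNReal.ofReal_le_ofReal ?_
    rcases lt_or_ge (dist a b) δ with h | h
    · have := hδφ h
      rw [dist_eq_norm] at this
      have h2 : 0 ≤ (K : ℝ) * ‖a - b‖ := mul_nonneg (NNReal.coe_nonneg K) (norm_nonneg _)
      linarith
    · rw [dist_eq_norm] at h
      have h1 : ‖φ a - φ b‖ ≤ 2 * M := (norm_sub_le _ _).trans (by linarith [hM a, hM b])
      have h2 : 2 * M ≤ 2 * M / δ * ‖a - b‖ := by
        rw [div_mul_eq_mul_div, le_div_iff₀ hδ]
        exact mul_le_mul_of_nonneg_left h (by linarith)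
      have h3' : (0 : ℝ) ≤ (ε / 3 : NNReal) := NNReal.coe_nonneg _
      exact h1.trans (h2.trans (le_add_of_nonneg_left h3'))
  refine ⟨K, fun ρ _ S T hS hT => ?_⟩
  have hgφ : AEMeasurable (fun x => ‖g x - φ (j x)‖ₑ) μ :=
    (hg.aestronglyMeasurable.sub
      (hφ.comp_stronglyMeasurable hj.measurable.stronglyMeasurable).aestronglyMeasurable).enorm
  have hmove : ∀ R : Ω → X, MeasurePreserving R ρ μ →
      ∫⁻ x, ‖g (R x) - φ (j (R x))‖ₑ ∂ρ ≤ (ε / 3 : NNReal) := fun R hR => by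
    refine le_trans (le_of_eq ?_) hφ1
    rw [← hR.map_eq] at hgφ ⊢
    rw [lintegral_map' hgφ hR.measurable.aemeasurable]
  have hφS : ∀ R : Ω → X, MeasurePreserving R ρ μ → AEStronglyMeasurable (fun x => φ (j (R x))) ρ :=
    fun R hR => (hφ.comp_stronglyMeasurable
      (hj.measurable.comp hR.measurable).stronglyMeasurable).aestronglyMeasurable
  have hgS : ∀ R : Ω → X, MeasurePreserving R ρ μ → AEStronglyMeasurable (fun x => g (R x)) ρ :=
    fun R hR => hg.aestronglyMeasurable.comp_measurePreserving hR
  have hmid : ∫⁻ x, ‖φ (j (S x)) - φ (j (T x))‖ₑ ∂ρ ≤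
      (ε / 3 : NNReal) + K * ∫⁻ x, ‖j (S x) - j (T x)‖ₑ ∂ρ := by
    have hm : Measurable fun x => ‖j (S x) - j (T x)‖ₑ :=
      ((hj.measurable.comp hS.measurable).sub (hj.measurable.comp hT.measurable)).enorm
    calc _ ≤ ∫⁻ x, ((ε / 3 : NNReal) + K * ‖j (S x) - j (T x)‖ₑ) ∂ρ :=
          lintegral_mono fun x => hφK _ _
      _ = _ := by
        rw [lintegral_add_left measurable_const, lintegral_const_mul _ hm]
        simp
  calc ∫⁻ x, ‖g (S x) - g (T x)‖ₑ ∂ρ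
      ≤ ∫⁻ x, ‖g (S x) - φ (j (S x))‖ₑ ∂ρ + (∫⁻ x, ‖φ (j (S x)) - φ (j (T x))‖ₑ ∂ρ
        + ∫⁻ x, ‖φ (j (T x)) - g (T x)‖ₑ ∂ρ) :=
        (lintegral_enorm_sub_le (hgS S hS) (hφS S hS)).trans
          (add_le_add le_rfl (lintegral_enorm_sub_le (hφS S hS) (hφS T hT)))
    _ ≤ (ε / 3 : NNReal) + (((ε / 3 : NNReal) + K * ∫⁻ x, ‖j (S x) - j (T x)‖ₑ ∂ρ)
        + (ε / 3 : NNReal)) := by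
        refine add_le_add (hmove S hS) (add_le_add hmid ?_)
        rw [lintegral_enorm_sub_comm]
        exact hmove T hT
    _ = ε + K * ∫⁻ x, ‖j (S x) - j (T x)‖ₑ ∂ρ := by
        have : (ε : ℝ≥0∞) = (ε / 3 : NNReal) + (ε / 3 : NNReal) + (ε / 3 : NNReal) := by
          rw [← ENNReal.coe_add, ← ENNReal.coe_add]
          congr 1
          rw [← add_div, ← add_div, eq_div_iff (by norm_num)]
          ring
        rw [this]
        ring

/-- Convergence tested on the one function `j` passes to every integrable `g`, in particular to
indicators, which is how an `L¹` metric can describe the weak topology. -/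
theorem tendsto_lintegral_enorm_comp_sub [NormedSpace ℝ E] {μ : Measure X} {ρ : Measure Ω}
    [IsProbabilityMeasure μ] [IsProbabilityMeasure ρ] {j : X → ℝ} (hj : MeasurableEmbedding j)
    {g : X → E} (hg : Integrable g μ) {α : Type*} {l : Filter α} {S : α → Ω → X} {T : Ω → X}
    (hS : ∀ a, MeasurePreserving (S a) ρ μ) (hT : MeasurePreserving T ρ μ)
    (h : Tendsto (fun a => ∫⁻ x, ‖j (S a x) - j (T x)‖ₑ ∂ρ) l (𝓝 0)) :
    Tendsto (fun a => ∫⁻ x, ‖g (S a x) - g (T x)‖ₑ ∂ρ) l (𝓝 0) := by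
  rw [ENNReal.tendsto_nhds_zero]
  intro ε hε
  obtain ⟨ε', hε'0, hε'⟩ := ENNReal.lt_iff_exists_nnreal_btwn.1 hε
  have hε'1 : 0 < ε' := by exact_mod_cast hε'0
  obtain ⟨K, hK⟩ := exists_lintegral_enorm_comp_sub_le (Ω := Ω) hj hg (half_pos hε'1)
  have h2 : Tendsto (fun a => (K : ℝ≥0∞) * ∫⁻ x, ‖j (S a x) - j (T x)‖ₑ ∂ρ) l (𝓝 0) := by
    simpa using ENNReal.Tendsto.const_mul h (Or.inr ENNReal.coe_ne_top)
  have h4 : (0 : ℝ≥0∞) < (ε' / 2 : NNReal) := by exact_mod_cast half_pos hε'1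
  filter_upwards [(ENNReal.tendsto_nhds_zero.1 h2) _ h4] with a ha
  calc _ ≤ ((ε' / 2 : NNReal) : ℝ≥0∞) + (ε' / 2 : NNReal) :=
        (hK ρ _ _ (hS a) hT).trans (add_le_add le_rfl ha)
    _ = ε' := by rw [← ENNReal.coe_add, add_halves]
    _ ≤ ε := hε'.le

end Approximation

/-! ### Complete pseudometrizability of the weak topology -/

namespace MPMap

variable {X : Type*} [MeasurableSpace X] {μ : Measure X}

theorem measurePreserving (T : MPMap μ) : MeasurePreserving T μ μ := T.2

theorem measurable (T : MPMap μ) : Measurable T := T.1.measurable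

/-- The inverse of an invertible measure-preserving map. -/
def inv (T : MPMap μ) : MPMap μ := ⟨T.1.symm, MeasurePreserving.symm T.1 T.2⟩

@[simp] theorem inv_apply_self (T : MPMap μ) (x : X) : T.inv (T x) = x := T.1.symm_apply_apply x

theorem tendsto_nhds_iff {α : Type*} {l : Filter α} {S : α → MPMap μ} {T : MPMap μ} :
    Tendsto S l (𝓝 T) ↔ ∀ A, MeasurableSet A →
      Tendsto (fun a => μ ((S a ⁻¹' A) ∆ (T ⁻¹' A))) l (𝓝 0) := by
  rw [TopologicalSpace.tendsto_nhds_generateFrom_iff]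
  constructor
  · intro h A hA
    rw [ENNReal.tendsto_nhds_zero]
    intro ε hε
    have := h {S : MPMap μ | μ ((S ⁻¹' A) ∆ (T ⁻¹' A)) < ε} ⟨T, A, ε, hA, rfl⟩ (by simpa using hε)
    filter_upwards [this] with a ha using le_of_lt ha
  · rintro h _ ⟨T', A, ε, hA, rfl⟩ hT
    have hr : 0 < ε - μ ((T ⁻¹' A) ∆ (T' ⁻¹' A)) := tsub_pos_of_lt hT
    have h2 := (h A hA).eventually_lt_const hr
    filter_upwards [h2] with a ha
    calc μ ((S a ⁻¹' A) ∆ (T' ⁻¹' A))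
        ≤ μ ((S a ⁻¹' A) ∆ (T ⁻¹' A)) + μ ((T ⁻¹' A) ∆ (T' ⁻¹' A)) := measure_symmDiff_le _ _ _
      _ < ε := lt_tsub_iff_right.1 ha

/-- Pulling back by `S`, which preserves `μ`, trades closeness of the inverses for closeness of `S`
and `T` on another set. Continuity of inversion follows. -/
theorem measure_symmDiff_preimage_inv (S T : MPMap μ) {A : Set X} (hA : MeasurableSet A) :
    μ ((S.inv ⁻¹' A) ∆ (T.inv ⁻¹' A)) =
      μ ((S ⁻¹' (T.inv ⁻¹' A)) ∆ (T ⁻¹' (T.inv ⁻¹' A))) := by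
  have h : (S ⁻¹' (T.inv ⁻¹' A)) ∆ (T ⁻¹' (T.inv ⁻¹' A)) =
      S ⁻¹' ((S.inv ⁻¹' A) ∆ (T.inv ⁻¹' A)) := by
    ext x
    simp only [mem_symmDiff, mem_preimage, inv_apply_self]
    tauto
  rw [h, S.measurePreserving.measure_preimage
    ((S.inv.measurable hA).symmDiff (T.inv.measurable hA)).nullMeasurableSet]

theorem continuous_inv : Continuous (inv : MPMap μ → MPMap μ) := by
  refine continuous_iff_continuousAt.2 fun T => tendsto_nhds_iff.2 fun A hA => ?_
  simp only [measure_symmDiff_preimage_inv _ T hA]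
  exact tendsto_nhds_iff.1 tendsto_id _ (T.inv.measurable hA)

section L1

variable {E : Type*} [NormedAddCommGroup E]

theorem aestronglyMeasurable_comp (T : MPMap μ) {g : X → E} (hg : AEStronglyMeasurable g μ) :
    AEStronglyMeasurable (fun x => g (T x)) μ := hg.comp_measurePreserving T.measurePreserving

theorem lintegral_comp (T : MPMap μ) (g : X → ℝ≥0∞) :
    ∫⁻ x, g (T x) ∂μ = ∫⁻ x, g x ∂μ :=
  T.measurePreserving.lintegral_comp_emb T.1.measurableEmbedding g

/-- Composition with an integrable function is continuous from the weak topology to `L¹`. -/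
theorem tendsto_lintegral_enorm_comp_sub_nhds [NormedSpace ℝ E] [IsFiniteMeasure μ] (T : MPMap μ) {g : X → E}
    (hg : Integrable g μ) :
    Tendsto (fun S : MPMap μ => ∫⁻ x, ‖g (S x) - g (T x)‖ₑ ∂μ) (𝓝 T) (𝓝 0) := by
  refine Integrable.induction (P := fun g : X → E =>
    Tendsto (fun S : MPMap μ => ∫⁻ x, ‖g (S x) - g (T x)‖ₑ ∂μ) (𝓝 T) (𝓝 0)) ?_ ?_ ?_ ?_ hg
  · intro c A hA _
    simp only [lintegral_enorm_indicator_comp_sub hA c (measurable _) T.measurable]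
    simpa using ENNReal.Tendsto.const_mul (tendsto_nhds_iff.1 tendsto_id _ hA) (Or.inr enorm_ne_top)
  · intro f g _ hf hg hf1 hg1
    refine tendsto_of_tendsto_of_tendsto_of_le_of_le tendsto_const_nhds
      (by simpa using hf1.add hg1) (fun _ => zero_le) fun S => ?_
    have hm : AEMeasurable (fun x => ‖f (S x) - f (T x)‖ₑ) μ :=
      ((S.aestronglyMeasurable_comp hf.aestronglyMeasurable).sub
        (T.aestronglyMeasurable_comp hf.aestronglyMeasurable)).enorm
    rw [← lintegral_add_left' hm]
    refine lintegral_mono fun x => ?_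
    simp only [Pi.add_apply, add_sub_add_comm]
    exact enorm_add_le _ _
  · refine isClosed_of_closure_subset fun f hf => ?_
    change Tendsto (fun S : MPMap μ => ∫⁻ x, ‖f (S x) - f (T x)‖ₑ ∂μ) (𝓝 T) (𝓝 0)
    rw [ENNReal.tendsto_nhds_zero]
    intro ε hε
    obtain ⟨g, hfg, hg⟩ : ∃ g : Lp E 1 μ, edist f g < ε / 3 ∧ g ∈ {f : Lp E 1 μ |
        Tendsto (fun S : MPMap μ => ∫⁻ x, ‖f (S x) - f (T x)‖ₑ ∂μ) (𝓝 T) (𝓝 0)} := by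
      obtain ⟨g, hg, hfg⟩ := EMetric.mem_closure_iff.1 hf (ε / 3)
        (ENNReal.div_pos hε.ne' (by norm_num))
      exact ⟨g, hfg, hg⟩
    have h3 : (0 : ℝ≥0∞) < ε / 3 := ENNReal.div_pos hε.ne' (by norm_num)
    have hfg' : ∫⁻ x, ‖f x - g x‖ₑ ∂μ ≤ ε / 3 := by
      rw [L1.edist_def] at hfg
      simpa only [edist_eq_enorm_sub] using hfg.le
    have hfm := (Lp.stronglyMeasurable f).aestronglyMeasurable (μ := μ)
    have hgm := (Lp.stronglyMeasurable g).aestronglyMeasurable (μ := μ)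
    filter_upwards [ENNReal.tendsto_nhds_zero.1 hg _ h3] with S hS
    calc ∫⁻ x, ‖f (S x) - f (T x)‖ₑ ∂μ
        ≤ ∫⁻ x, ‖f (S x) - g (S x)‖ₑ ∂μ + (∫⁻ x, ‖g (S x) - g (T x)‖ₑ ∂μ
          + ∫⁻ x, ‖g (T x) - f (T x)‖ₑ ∂μ) :=
          (lintegral_enorm_sub_le (S.aestronglyMeasurable_comp hfm)
            (S.aestronglyMeasurable_comp hgm)).trans (add_le_add le_rfl
            (lintegral_enorm_sub_le (S.aestronglyMeasurable_comp hgm)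
              (T.aestronglyMeasurable_comp hgm)))
      _ ≤ ε / 3 + (ε / 3 + ε / 3) := by
          rw [S.lintegral_comp fun x => ‖f x - g x‖ₑ, T.lintegral_comp fun x => ‖g x - f x‖ₑ,
            lintegral_enorm_sub_comm g f]
          gcongr
      _ = ε := by rw [← add_assoc, ENNReal.add_thirds]
  · intro f g hfg _ hf
    refine hf.congr fun S => lintegral_congr_ae ?_
    filter_upwards [S.measurePreserving.quasiMeasurePreserving.ae hfg,
      T.measurePreserving.quasiMeasurePreserving.ae hfg] with x h1 h2
    rw [h1, h2]

end L1

section Baire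

/-- The pair `(j ∘ T, j ∘ T⁻¹)` in `L¹ × L¹`. -/
noncomputable def toL1Pair {j : X → ℝ} (hji : Integrable j μ) (T : MPMap μ) :
    Lp ℝ 1 μ × Lp ℝ 1 μ :=
  (Integrable.toL1 (fun x => j (T x)) (T.measurePreserving.integrable_comp_of_integrable hji),
    Integrable.toL1 (fun x => j (T.inv x)) (T.inv.measurePreserving.integrable_comp_of_integrable hji))

variable {j : X → ℝ}

theorem edist_fst_toL1Pair (hji : Integrable j μ) (S T : MPMap μ) :
    edist (toL1Pair hji S).1 (toL1Pair hji T).1 = ∫⁻ x, ‖j (S x) - j (T x)‖ₑ ∂μ := by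
  simp only [toL1Pair, Integrable.edist_toL1_toL1]
  simp only [edist_eq_enorm_sub]

theorem edist_snd_toL1Pair (hji : Integrable j μ) (S T : MPMap μ) :
    edist (toL1Pair hji S).2 (toL1Pair hji T).2 = ∫⁻ x, ‖j (S.inv x) - j (T.inv x)‖ₑ ∂μ := by
  simp only [toL1Pair, Integrable.edist_toL1_toL1]
  simp only [edist_eq_enorm_sub]

variable [IsProbabilityMeasure μ]

/-- The first coordinate alone already induces the topology, by testing on indicators. The second is
continuous by `continuous_inv` and is carried along to make the range closed. -/
theorem isInducing_toL1Pair (hj : MeasurableEmbedding j) (hji : Integrable j μ) :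
    IsInducing (toL1Pair hji) := by
  refine isInducing_iff_nhds.2 fun T => le_antisymm ?_ ?_
  · rw [← tendsto_iff_comap, nhds_prod_eq, tendsto_prod_iff']
    simp only [tendsto_iff_edist_tendsto_0, edist_fst_toL1Pair, edist_snd_toL1Pair]
    exact ⟨T.tendsto_lintegral_enorm_comp_sub_nhds hji,
      (T.inv.tendsto_lintegral_enorm_comp_sub_nhds hji).comp (continuous_inv.tendsto T)⟩
  · refine (tendsto_nhds_iff (l := comap (toL1Pair hji) (𝓝 (toL1Pair hji T))) (S := id)).2 fun A hA => ?_
    have h1 : Tendsto (fun S : MPMap μ => ∫⁻ x, ‖j (S x) - j (T x)‖ₑ ∂μ)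
        (comap (toL1Pair hji) (𝓝 (toL1Pair hji T))) (𝓝 0) := by
      simp only [← edist_fst_toL1Pair hji]
      rw [← tendsto_iff_edist_tendsto_0]
      exact (continuous_fst.tendsto _).comp tendsto_comap
    have h2 := tendsto_lintegral_enorm_comp_sub hj
      (g := A.indicator fun _ => (1 : ℝ)) ((integrable_const 1).indicator hA)
      (fun S => S.measurePreserving) T.measurePreserving h1
    simp only [lintegral_enorm_indicator_comp_sub hA (1 : ℝ) (measurable _) T.measurable,
      enorm_one, one_mul] at h2
    exact h2

/-- A limit in `L¹` of functions `j ∘ T n` with `T n` measure-preserving has the same form. -/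
theorem exists_measurePreserving_of_tendsto [Nonempty X] (hj : MeasurableEmbedding j)
    {T : ℕ → X → X} (hT : ∀ n, MeasurePreserving (T n) μ μ) {g : X → ℝ} (hg : Measurable g)
    (h : Tendsto (fun n => ∫⁻ x, ‖j (T n x) - g x‖ₑ ∂μ) atTop (𝓝 0)) :
    ∃ S : X → X, MeasurePreserving S μ μ ∧ ∀ᵐ x ∂μ, j (S x) = g x := by
  have hjT : ∀ n, Measurable fun x => j (T n x) := fun n => hj.measurable.comp (hT n).measurable
  have hmeas : TendstoInMeasure μ (fun n x => j (T n x)) atTop g := by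
    refine tendstoInMeasure_of_tendsto_eLpNorm one_ne_zero
      (fun n => (hjT n).aestronglyMeasurable) hg.aestronglyMeasurable ?_
    simpa only [eLpNorm_one_eq_lintegral_enorm, Pi.sub_apply] using h
  have hd1 := hmeas.tendstoInDistribution fun n => (hjT n).aemeasurable
  have hmap : ∀ n, μ.map (fun x => j (T n x)) = μ.map j := fun n => by
    have := Measure.map_map (μ := μ) hj.measurable (hT n).measurable
    rw [(hT n).map_eq] at this
    exact this.symm
  have hd2 : TendstoInDistribution (fun n x => j (T n x)) atTop j (fun _ => μ) μ := by
    refine ⟨fun n => (hjT n).aemeasurable, hj.measurable.aemeasurable, ?_⟩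
    refine tendsto_const_nhds.congr fun n => ?_
    exact Subtype.ext (hmap n).symm
  -- All `j ∘ T n` have the law of `j`, and so does their limit. Hence `g` takes values in the range
  -- of `j` almost everywhere and can be composed with a left inverse of `j`.
  have hgj : μ.map g = μ.map j := tendstoInDistribution_unique _ hd1 hd2
  obtain ⟨r, hr, hrj⟩ := hj.exists_measurable_extend measurable_id fun _ => inferInstance
  have hrange : ∀ᵐ x ∂μ, g x ∈ range j := by
    have hm : MeasurableSet {t | t ∈ range j} := hj.measurableSet_range
    have h1 : ∀ᵐ t ∂(μ.map j), t ∈ range j := by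
      rw [ae_map_iff hj.measurable.aemeasurable hm]
      exact Eventually.of_forall mem_range_self
    rwa [← hgj, ae_map_iff hg.aemeasurable hm] at h1
  refine ⟨r ∘ g, ⟨hr.comp hg, ?_⟩, ?_⟩
  · rw [← Measure.map_map hr hg, hgj, Measure.map_map hr hj.measurable, hrj, Measure.map_id]
  · filter_upwards [hrange] with x hx
    obtain ⟨y, hy⟩ := hx
    have : r (j y) = y := congrFun hrj y
    simp only [Function.comp, ← hy, this]

/-- A limit of pairs produces limits `R` and `S` of the maps and of their inverses, and `S ∘ R = id`
survives the passage to the limit. Without the second coordinate the limit could fail to be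
invertible. -/
theorem isClosed_range_toL1Pair [StandardBorelSpace X] [NullSingletonClass μ]
    (hj : MeasurableEmbedding j) (hji : Integrable j μ) : IsClosed (range (toL1Pair hji)) := by
  have hne : Nonempty X := by
    by_contra h
    have := not_nonempty_iff.1 h
    exact IsProbabilityMeasure.ne_zero μ (Measure.eq_zero_of_isEmpty μ)
  refine IsSeqClosed.isClosed fun u p hu hp => ?_
  choose T hT using hu
  have h1 : Tendsto (fun n => ∫⁻ x, ‖j (T n x) - p.1 x‖ₑ ∂μ) atTop (𝓝 0) := by
    have := tendsto_iff_edist_tendsto_0.1 ((continuous_fst.tendsto _).comp hp)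
    refine this.congr fun n => ?_
    rw [Function.comp, ← hT n, L1.edist_def]
    refine lintegral_congr_ae ?_
    filter_upwards [Integrable.coeFn_toL1
      ((T n).measurePreserving.integrable_comp_of_integrable hji)] with x hx
    rw [edist_eq_enorm_sub]
    exact congrArg (fun t => ‖t - p.1 x‖ₑ) hx
  have h2 : Tendsto (fun n => ∫⁻ x, ‖j ((T n).inv x) - p.2 x‖ₑ ∂μ) atTop (𝓝 0) := by
    have := tendsto_iff_edist_tendsto_0.1 ((continuous_snd.tendsto _).comp hp)
    refine this.congr fun n => ?_
    rw [Function.comp, ← hT n, L1.edist_def]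
    refine lintegral_congr_ae ?_
    filter_upwards [Integrable.coeFn_toL1
      ((T n).inv.measurePreserving.integrable_comp_of_integrable hji)] with x hx
    rw [edist_eq_enorm_sub]
    exact congrArg (fun t => ‖t - p.2 x‖ₑ) hx
  obtain ⟨R, hR, hRj⟩ := exists_measurePreserving_of_tendsto hj
    (fun n => (T n).measurePreserving) (Lp.stronglyMeasurable p.1).measurable h1
  obtain ⟨S, hS, hSj⟩ := exists_measurePreserving_of_tendsto hj
    (fun n => (T n).inv.measurePreserving) (Lp.stronglyMeasurable p.2).measurable h2
  replace h1 : Tendsto (fun n => ∫⁻ x, ‖j (T n x) - j (R x)‖ₑ ∂μ) atTop (𝓝 0) := by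
    refine h1.congr fun n => lintegral_congr_ae ?_
    filter_upwards [hRj] with x hx
    rw [hx]
  replace h2 : Tendsto (fun n => ∫⁻ x, ‖j ((T n).inv x) - j (S x)‖ₑ ∂μ) atTop (𝓝 0) := by
    refine h2.congr fun n => lintegral_congr_ae ?_
    filter_upwards [hSj] with x hx
    rw [hx]
  have hjS : Integrable (fun x => j (S x)) μ := hS.integrable_comp_of_integrable hji
  have hSR : ∀ᵐ x ∂μ, S (R x) = x := by
    have h3 := tendsto_lintegral_enorm_comp_sub hj hjS (fun n => (T n).measurePreserving) hR h1
    have h4 : ∫⁻ x, ‖j (S (R x)) - j x‖ₑ ∂μ = 0 := by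
      have h5 := h3.add h2
      rw [add_zero] at h5
      refine le_antisymm (ge_of_tendsto' h5 fun n => ?_) zero_le
      have hm : ∀ Q : X → X, MeasurePreserving Q μ μ →
          AEStronglyMeasurable (fun x => j (S (Q x))) μ := fun Q hQ =>
        (hj.measurable.comp (hS.measurable.comp hQ.measurable)).aestronglyMeasurable
      -- The comparison goes through `S ∘ T n`; the second error is the integral of `‖j ∘ (T n)⁻¹ -
      -- j ∘ S‖` transported by `T n`, using `(T n)⁻¹ ∘ T n = id`.
      refine (lintegral_enorm_sub_le (hm R hR) (hm _ (T n).measurePreserving)).trans ?_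
      refine add_le_add (lintegral_enorm_sub_comm _ _).le ?_
      rw [← (T n).lintegral_comp fun x => ‖j ((T n).inv x) - j (S x)‖ₑ, lintegral_enorm_sub_comm]
      simp
    have hm : Measurable fun x => ‖j (S (R x)) - j x‖ₑ :=
      ((hj.measurable.comp (hS.measurable.comp hR.measurable)).sub hj.measurable).enorm
    rw [lintegral_eq_zero_iff hm] at h4
    filter_upwards [h4] with x hx
    simpa [sub_eq_zero, hj.injective.eq_iff] using hx
  obtain ⟨e, he, heR⟩ := hR.exists_measurableEquiv_ae_eq hS.measurable hSR
  refine ⟨⟨e, he⟩, Prod.ext (Lp.ext ?_) (Lp.ext ?_)⟩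
  · refine (Integrable.coeFn_toL1 ((measurePreserving
      (⟨e, he⟩ : MPMap μ)).integrable_comp_of_integrable hji)).trans ?_
    filter_upwards [heR, hRj] with x h1 h2
    rw [← h2, ← h1]
    rfl
  · refine (Integrable.coeFn_toL1 ((measurePreserving
      (inv (⟨e, he⟩ : MPMap μ))).integrable_comp_of_integrable hji)).trans ?_
    have h5 : ∀ᵐ y ∂μ, e.symm y = S y := by
      have hm : MeasurableSet {y | e.symm y = S y} :=
        measurableSet_eq_fun e.symm.measurable hS.measurable
      rw [← hR.map_eq, ae_map_iff hR.measurable.aemeasurable hm]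
      filter_upwards [heR, hSR] with x h1 h2
      rw [h2, ← h1, e.symm_apply_apply]
    filter_upwards [h5, hSj] with x h1 h2
    rw [← h2, ← h1]
    rfl

/-- The weak topology on the invertible measure-preserving maps of a standard atomless probability
space is completely pseudometrizable. -/
instance isCompletelyPseudoMetrizableSpace [StandardBorelSpace X] [NullSingletonClass μ] :
    TopologicalSpace.IsCompletelyPseudoMetrizableSpace (MPMap μ) := by
  let j : X → ℝ := fun x => Real.sigmoid (embeddingReal X x)
  have hjm : Measurable j :=
    continuous_sigmoid.measurable.comp (measurableEmbedding_embeddingReal X).measurable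
  have hj : MeasurableEmbedding j := hjm.measurableEmbedding
    (Real.sigmoid_strictMono.injective.comp (measurableEmbedding_embeddingReal X).injective)
  have hji : Integrable j μ := by
    refine Integrable.of_bound hjm.aestronglyMeasurable 1 (Eventually.of_forall fun x => ?_)
    rw [Real.norm_eq_abs, abs_of_pos (Real.sigmoid_pos _)]
    exact (Real.sigmoid_lt_one _).le
  have hind := isInducing_toL1Pair hj hji
  let := hind.comapPseudoMetricSpace
  have hu : IsUniformInducing (toL1Pair hji) := ⟨rfl⟩
  have : CompleteSpace (MPMap μ) := by
    rw [completeSpace_iff_isComplete_range hu]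
    exact (isClosed_range_toL1Pair hj hji).isComplete
  infer_instance

end Baire

end MPMap

/-! ### Approximation by maps transported from an extension -/

namespace MPMap

variable {X : Type*} [MeasurableSpace X] {μ : Measure X}

/-- Approximations indexed by a finite family of sets and a tolerance form a net converging to `T`.
Both density proofs reduce to this criterion. -/
theorem mem_closure_of_forall_finset {D : Set (MPMap μ)} {T : MPMap μ}
    (h : ∀ (F : Finset {A : Set X // MeasurableSet A}) (n : ℕ), ∃ S ∈ D, ∀ A ∈ F,
      μ ((S ⁻¹' A) ∆ (T ⁻¹' A)) ≤ (n : ℝ≥0∞)⁻¹) : T ∈ closure D := by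
  choose S hSD hS using fun p : Finset {A : Set X // MeasurableSet A} × ℕ => h p.1 p.2
  refine mem_closure_of_tendsto (b := atTop) (f := S) ?_ (Eventually.of_forall hSD)
  refine tendsto_nhds_iff.2 fun A hA => ?_
  have h1 : Tendsto (fun p : Finset {A : Set X // MeasurableSet A} × ℕ => (p.2 : ℝ≥0∞)⁻¹)
      atTop (𝓝 0) := by
    rw [← prod_atTop_atTop_eq]
    exact ENNReal.tendsto_inv_nat_nhds_zero.comp tendsto_snd
  refine tendsto_of_tendsto_of_tendsto_of_le_of_le' tendsto_const_nhds h1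
    (Eventually.of_forall fun _ => zero_le) ?_
  filter_upwards [eventually_ge_atTop (({⟨A, hA⟩}, 0) : Finset {A : Set X // MeasurableSet A} × ℕ)]
    with p hp
  exact hS p ⟨A, hA⟩ (hp.1 (Finset.mem_singleton_self _))

variable {Y : Type*} [MeasurableSpace Y] {ν : Measure Y}

/-- Transport of an invertible measure-preserving map along an isomorphism. -/
def conj (Φ : X ≃ᵐ Y) (hΦ : MeasurePreserving Φ μ ν) (S : MPMap ν) : MPMap μ :=
  ⟨Φ.trans (S.1.trans Φ.symm),
    (MeasurePreserving.symm Φ hΦ).comp (S.measurePreserving.comp hΦ)⟩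

theorem apply_conj (Φ : X ≃ᵐ Y) (hΦ : MeasurePreserving Φ μ ν) (S : MPMap ν) (x : X) :
    Φ (conj Φ hΦ S x) = S (Φ x) := Φ.apply_symm_apply _

theorem apply_conj_iterate (Φ : X ≃ᵐ Y) (hΦ : MeasurePreserving Φ μ ν) (S : MPMap ν) (x : X)
    (k : ℕ) : Φ ((conj Φ hΦ S)^[k] x) = S^[k] (Φ x) :=
  (Function.Semiconj.iterate_right (f := Φ) (apply_conj Φ hΦ S) k) x

/-- If `S` is an invertible measure-preserving map of an extension `π : Y → X` which is, up to
measure `ε`, a lift of `T`, then some transported copy of `S` on `X` is close to `T`. The transport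
can be chosen to respect finitely many sets. -/
theorem exists_conj_close [StandardBorelSpace X] [StandardBorelSpace Y] [IsProbabilityMeasure μ]
    [IsProbabilityMeasure ν] [NullSingletonClass μ] [NullSingletonClass ν] (T : MPMap μ)
    (S : MPMap ν) {π : Y → X} (hπ : MeasurePreserving π ν μ) {ε : ℝ≥0∞}
    (hS : ν {y | π (S y) ≠ T (π y)} ≤ ε) (F : Finset {A : Set X // MeasurableSet A}) {C : Set X}
    (hC : MeasurableSet C) :
    ∃ (Φ : X ≃ᵐ Y) (hΦ : MeasurePreserving Φ μ ν), (∀ᵐ x ∂μ, π (Φ x) ∈ C ↔ x ∈ C) ∧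
      ∀ A ∈ F, μ ((conj Φ hΦ S ⁻¹' A) ∆ (T ⁻¹' A)) ≤ ε := by
  classical
  -- The isomorphism must match `C`, each `A` and each `T ⁻¹' A` with their lifts along `π`. These
  -- sets generate a finite partition, coded by `c ∘ r`, whose lift has the same law because `π`
  -- preserves measure.
  let F' : Finset {A : Set X // MeasurableSet A} :=
    insert ⟨C, hC⟩ (F ∪ F.image fun A : {A : Set X // MeasurableSet A} => ⟨T ⁻¹' A, T.measurable A.2⟩)
  let r : X → (F' → Bool) := fun x A => decide (x ∈ A.1.1)
  have hr : Measurable r := measurable_pi_iff.2 fun A =>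
    measurable_to_bool (by
      have : (fun x => r x A) ⁻¹' {true} = A.1.1 := by ext; simp [r]
      rw [this]
      exact A.1.2)
  let c : (F' → Bool) → ℕ := fun s => Fintype.equivFin (F' → Bool) s
  have hc : Function.Injective c := Fin.val_injective.comp (Equiv.injective _)
  have hq : Measurable (c ∘ r) := (measurable_of_countable c).comp hr
  obtain ⟨Φ, hΦ, hΦq⟩ := exists_measurableEquiv_comp_ae_eq (μ := μ) (ν := ν) hq
    (hq.comp hπ.measurable) (by rw [← Measure.map_map hq hπ.measurable, hπ.map_eq])
  have hF' : ∀ A ∈ F', ∀ᵐ x ∂μ, π (Φ x) ∈ A.1 ↔ x ∈ A.1 := fun A hA => by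
    filter_upwards [hΦq] with x hx
    have h1 := congrFun (hc hx) ⟨A, hA⟩
    exact decide_eq_decide.1 h1
  refine ⟨Φ, hΦ, hF' ⟨C, hC⟩ (Finset.mem_insert_self _ _), fun A hA => ?_⟩
  have h1 := (conj Φ hΦ S).measurePreserving.quasiMeasurePreserving.ae
    (hF' A (Finset.mem_insert_of_mem (Finset.mem_union_left _ hA)))
  have h2 := hF' ⟨T ⁻¹' A, T.measurable A.2⟩ (Finset.mem_insert_of_mem
    (Finset.mem_union_right _ (Finset.mem_image_of_mem _ hA)))
  have hm : MeasurableSet {y | π (S y) ≠ T (π y)} :=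
    (measurableSet_eq_fun (hπ.measurable.comp S.measurable)
      (T.measurable.comp hπ.measurable)).compl
  -- Where `π ∘ S` and `T ∘ π` agree at `Φ x`, the matched sets give `conj Φ hΦ S x ∈ A` iff `T x ∈
  -- A`, for almost every such `x`. So the symmetric difference lies over the exceptional set.
  refine le_trans ?_ ((hΦ.measure_preimage hm.nullMeasurableSet).le.trans hS)
  refine measure_mono_ae ?_
  filter_upwards [h1, h2] with x hx1 hx2 hx
  rw [apply_conj] at hx1
  intro heq
  have heq' : π (S (Φ x)) = T (π (Φ x)) := by
    by_contra hne
    exact hne heq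
  have hx' : x ∈ (conj Φ hΦ S ⁻¹' A) ∆ (T ⁻¹' A) := hx
  simp only [mem_preimage] at hx2
  rw [heq'] at hx1
  simp only [mem_symmDiff, mem_preimage] at hx'
  tauto

end MPMap

/-! ### Skew products over permutations of a finite set -/

section Skew

variable {ι Z : Type*} [Fintype ι] [MeasurableSpace ι] [DiscreteMeasurableSpace ι]
  [MeasurableSpace Z]

/-- The equidistributed probability measure on a finite type. -/
noncomputable def finiteUniform (ι : Type*) [Fintype ι] [MeasurableSpace ι] : Measure ι :=
  (Fintype.card ι : ℝ≥0∞)⁻¹ • Measure.count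

theorem finiteUniform_apply (s : Finset ι) :
    finiteUniform ι s = (Fintype.card ι : ℝ≥0∞)⁻¹ * s.card := by
  rw [finiteUniform, Measure.smul_apply, Measure.count_apply_finset, smul_eq_mul]

instance [Nonempty ι] : IsProbabilityMeasure (finiteUniform ι) := ⟨by
  rw [← Finset.coe_univ, finiteUniform_apply, Finset.card_univ]
  exact ENNReal.inv_mul_cancel (by simp) (by simp)⟩

theorem measurePreserving_finiteUniform (σ : Equiv.Perm ι) :
    MeasurePreserving σ (finiteUniform ι) (finiteUniform ι) := by
  refine ⟨Measurable.of_discrete, ?_⟩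
  rw [finiteUniform, Measure.map_smul]
  congr 1
  refine Measure.ext fun s hs => ?_
  rw [Measure.map_apply Measurable.of_discrete hs, Measure.count_apply (.of_discrete),
    Measure.count_apply hs]
  congr 1
  rw [← Equiv.image_symm_eq_preimage]
  exact (Equiv.injective _).encard_image s

/-- The skew product of a permutation of a finite type with equivalences of the fibre. -/
def skewEquiv (σ : Equiv.Perm ι) (g : ι → Z ≃ᵐ Z) : ι × Z ≃ᵐ ι × Z where
  toFun p := (σ p.1, g p.1 p.2)
  invFun p := (σ.symm p.1, (g (σ.symm p.1)).symm p.2)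
  left_inv p := by simp
  right_inv p := by simp
  measurable_toFun := measurable_from_prod_countable_right fun i =>
    (measurable_const (a := σ i)).prodMk (g i).measurable
  measurable_invFun := measurable_from_prod_countable_right fun i =>
    (measurable_const (a := σ.symm i)).prodMk (g (σ.symm i)).symm.measurable

@[simp] theorem skewEquiv_apply (σ : Equiv.Perm ι) (g : ι → Z ≃ᵐ Z) (p : ι × Z) :
    skewEquiv σ g p = (σ p.1, g p.1 p.2) := rfl

theorem measurePreserving_skewEquiv {ζ : Measure Z} [SFinite ζ] [Nonempty ι] (σ : Equiv.Perm ι)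
    {g : ι → Z ≃ᵐ Z} (hg : ∀ i, MeasurePreserving (g i) ζ ζ) :
    MeasurePreserving (skewEquiv σ g) ((finiteUniform ι).prod ζ) ((finiteUniform ι).prod ζ) :=
  (measurePreserving_finiteUniform σ).skew_product (g := fun i z => g i z)
    (measurable_from_prod_countable_right fun i => (g i).measurable)
    (Eventually.of_forall fun i => (hg i).map_eq)

end Skew

/-! ### Counting the visits of a cyclic clock -/

section Counting

variable {κ : Type*} [Fintype κ] [DecidableEq κ]

/-- Summing along a sequence `J` a function of the current value and of the number of its previous
occurrences. -/
theorem sum_range_occurrences (J : ℕ → κ) (h : κ → ℕ → ℝ) (N : ℕ) :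
    ∑ t ∈ Finset.range N, h (J t) ((Finset.range t).filter fun s => J s = J t).card =
      ∑ j, ∑ i ∈ Finset.range ((Finset.range N).filter fun s => J s = j).card, h j i := by
  induction N with
  | zero => simp
  | succ N ih =>
    have hstep : ∀ j, ∑ i ∈ Finset.range ((Finset.range (N + 1)).filter fun s => J s = j).card,
        h j i = (∑ i ∈ Finset.range ((Finset.range N).filter fun s => J s = j).card, h j i) +
          if J N = j then h j ((Finset.range N).filter fun s => J s = j).card else 0 := by
      intro j
      rw [Finset.range_add_one, Finset.filter_insert]
      split_ifs with hj
      · rw [Finset.card_insert_of_notMem (by simp), Finset.sum_range_succ]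
      · rw [add_zero]
    rw [Finset.sum_range_succ, ih, Finset.sum_congr rfl fun j _ => hstep j,
      Finset.sum_add_distrib, Finset.sum_ite_eq]
    simp

theorem ZMod.sum_range_natCast_add {N : ℕ} [NeZero N] (c : ZMod N) {M : Type*} [AddCommMonoid M]
    (f : ZMod N → M) : ∑ s ∈ Finset.range N, f (c + s) = ∑ a, f a := by
  rw [← Equiv.sum_comp (Equiv.addLeft c) f]
  refine Finset.sum_bij' (fun s _ => (s : ZMod N)) (fun a _ => a.val) (by simp)
    (fun a _ => Finset.mem_range.2 (ZMod.val_lt a)) (fun s hs => ?_) (by simp) (by simp)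
  exact ZMod.val_cast_of_lt (Finset.mem_range.1 hs)

end Counting

/-- The clock `c ↦ c / m` on `ZMod (n * m)`. -/
def clock (n m : ℕ) [NeZero n] [NeZero m] (c : ZMod (n * m)) : Fin n :=
  haveI : NeZero (n * m) := ⟨mul_ne_zero (NeZero.ne n) (NeZero.ne m)⟩
  ⟨c.val / m, Nat.div_lt_of_lt_mul (by rw [mul_comm m n]; exact ZMod.val_lt c)⟩

section Clock

variable (n m : ℕ) [NeZero n] [NeZero m]

/-- A full period meets every residue once, so the starting point is irrelevant and the count is the
length of one block. -/
theorem card_clock_eq (c : ZMod (n * m)) (j : Fin n) :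
    ((Finset.range (n * m)).filter fun s : ℕ => clock n m (c + s) = j).card = m := by
  have : NeZero (n * m) := ⟨mul_ne_zero (NeZero.ne n) (NeZero.ne m)⟩
  have hm : 0 < m := Nat.pos_of_ne_zero (NeZero.ne m)
  rw [Finset.card_filter, ZMod.sum_range_natCast_add c fun a => if clock n m a = j then 1 else 0,
    ← ZMod.sum_range_natCast_add 0, ← Finset.card_filter]
  have : (Finset.range (n * m)).filter (fun s : ℕ => clock n m (0 + s) = j) =
      Finset.Ico (j * m) (j * m + m) := by
    ext s
    simp only [Finset.mem_filter, Finset.mem_range, Finset.mem_Ico, zero_add, clock, Fin.ext_iff]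
    constructor
    · rintro ⟨hs, h⟩
      rw [ZMod.val_cast_of_lt hs] at h
      have h1 := Nat.div_mul_le_self s m
      have h2 := Nat.lt_div_mul_add hm (a := s)
      rw [h] at h1 h2
      exact ⟨h1, h2⟩
    · rintro ⟨h1, h2⟩
      have hs : s < n * m := by
        have : (j + 1 : ℕ) * m ≤ n * m := Nat.mul_le_mul_right m j.2
        rw [Nat.add_mul, one_mul] at this
        omega
      refine ⟨hs, ?_⟩
      rw [ZMod.val_cast_of_lt hs]
      refine le_antisymm (Nat.lt_succ_iff.1 ((Nat.div_lt_iff_lt_mul hm).2 ?_))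
        ((Nat.le_div_iff_mul_le hm).2 h1)
      rw [Nat.succ_mul]
      exact h2
  rw [this, Nat.card_Ico, Nat.add_sub_cancel_left]

/-- The wrap-around from the last residue to `0` is excluded as well, since `m` divides `n * m`. -/
theorem clock_add_one_of_not_dvd {c : ZMod (n * m)} (hc : ¬ m ∣ c.val + 1) :
    clock n m (c + 1) = clock n m c := by
  have : NeZero (n * m) := ⟨mul_ne_zero (NeZero.ne n) (NeZero.ne m)⟩
  have h1 : c.val + 1 < n * m := by
    refine lt_of_le_of_ne (ZMod.val_lt c) fun h => hc ?_
    rw [h]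
    exact dvd_mul_left m n
  have h2 : (c + 1).val = c.val + 1 := by
    have := ZMod.val_cast_of_lt h1
    rwa [Nat.cast_add, ZMod.natCast_zmod_val, Nat.cast_one] at this
  simp only [clock, h2, Nat.succ_div, if_neg hc, add_zero]

/-- Each block has only its last residue as a switching time, so the clock is injective on these.
Their proportion is at most `1 / m`. -/
theorem card_dvd_val_add_one_le [Fintype (ZMod (n * m))] :
    (Finset.univ.filter fun c : ZMod (n * m) => m ∣ c.val + 1).card ≤ n := by
  have : NeZero (n * m) := ⟨mul_ne_zero (NeZero.ne n) (NeZero.ne m)⟩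
  have : (Finset.univ.filter fun c : ZMod (n * m) => m ∣ c.val + 1).card ≤
      (Finset.univ : Finset (Fin n)).card := by
    refine Finset.card_le_card_of_injOn (clock n m) (fun _ _ => Finset.mem_univ _) ?_
    intro a ha b hb hab
    simp only [Finset.coe_filter, Finset.mem_univ, true_and, mem_ofPred_eq] at ha hb
    simp only [clock, Fin.ext_iff] at hab
    have key : ∀ v : ℕ, m ∣ v + 1 → v + 1 = m * (v / m + 1) := fun v hv => by
      have h1 := Nat.succ_div (a := v) (b := m)
      rw [if_pos hv] at h1
      rw [← h1, Nat.mul_div_cancel' hv]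
    have h1 := key _ ha
    have h2 := key _ hb
    rw [hab, ← h2] at h1
    exact ZMod.val_injective _ (Nat.succ_injective h1)
  simpa using this

end Clock

/-! ### A quantitative weak law of large numbers -/

section Independent

variable {X : Type*} [MeasurableSpace X]

open ProbabilityTheory

/-- A weak law of large numbers for coordinates of a finite product. -/
theorem lintegral_enorm_average_sub_le (μ : Measure X) [IsProbabilityMeasure μ] {h : X → ℝ}
    (hm : Measurable h) (h0 : ∀ x, 0 ≤ h x) (h1 : ∀ x, h x ≤ 1) (n : ℕ) [NeZero n] {ε : ℝ}
    (hε : 0 < ε) (hn : 1 / ε ^ 2 ≤ n) :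
    ∫⁻ z, ‖(n : ℝ)⁻¹ * ∑ j : Fin n, h (z j) - ∫ x, h x ∂μ‖ₑ ∂(Measure.pi fun _ : Fin n => μ) ≤
      ENNReal.ofReal ε := by
  have hn0 : (0 : ℝ) < n := lt_of_lt_of_le (by positivity) hn
  have hmem : MemLp h 2 μ := MemLp.of_bound hm.aestronglyMeasurable 1
    (Eventually.of_forall fun x => by rw [Real.norm_eq_abs, abs_of_nonneg (h0 x)]; exact h1 x)
  set P := Measure.pi fun _ : Fin n => μ with hP
  let Z : (Fin n → X) → ℝ := ∑ j : Fin n, fun z => h (z j)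
  have hZi : ∀ j : Fin n, MemLp (fun z : Fin n → X => h (z j)) 2 P := fun j =>
    hmem.comp_measurePreserving (measurePreserving_eval (fun _ : Fin n => μ) j)
  have hZ2 : MemLp Z 2 P := memLp_finsetSum' _ fun j _ => hZi j
  have hvar1 : Var[h; μ] ≤ 1 := by
    refine (variance_le_expectation_sq hm.aestronglyMeasurable).trans ?_
    calc ∫ x, (h ^ 2) x ∂μ ≤ ∫ _, (1 : ℝ) ∂μ := by
          refine integral_mono hmem.integrable_sq (integrable_const 1) fun x => ?_
          simpa using pow_le_one₀ (n := 2) (h0 x) (h1 x)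
      _ = 1 := by simp
  have hvar : Var[Z; P] ≤ n := by
    have := variance_sum_pi (μ := fun _ : Fin n => μ) (X := fun _ => h) fun _ => hmem
    simp only [Finset.sum_const, Finset.card_univ, Fintype.card_fin, nsmul_eq_mul] at this
    change Var[Z; P] = n * Var[h; μ] at this
    rw [this]
    exact mul_le_of_le_one_right hn0.le hvar1
  have hEZ : ∫ z, Z z ∂P = n * ∫ x, h x ∂μ := by
    have h3 : ∀ z, Z z = ∑ j : Fin n, h (z j) := fun z => by simp [Z]
    simp only [h3]
    rw [integral_finsetSum _ fun j _ => (hZi j).integrable (by norm_num)]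
    have h4 : ∀ j : Fin n, ∫ z, h (z j) ∂P = ∫ x, h x ∂μ := fun j => by
      rw [← (measurePreserving_eval (fun _ : Fin n => μ) j).map_eq,
        integral_map (measurable_pi_apply j).aemeasurable hm.aestronglyMeasurable]
    simp [h4]
  rw [variance_eq_integral hZ2.aestronglyMeasurable.aemeasurable] at hvar
  set D : (Fin n → X) → ℝ := fun z => Z z - ∫ z, Z z ∂P with hD
  have hD2 : MemLp D 2 P := hZ2.sub (memLp_const _)
  have heq : ∀ z, (n : ℝ)⁻¹ * ∑ j : Fin n, h (z j) - ∫ x, h x ∂μ = (n : ℝ)⁻¹ * D z := fun z => by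
    have hDz : D z = ∑ j : Fin n, h (z j) - n * ∫ x, h x ∂μ := by
      simp only [hD, hEZ]
      simp only [Z, Finset.sum_apply]
    rw [hDz]
    field_simp
  simp only [heq]
  have hDi : Integrable (fun z => (n : ℝ)⁻¹ * D z) P :=
    (hD2.integrable (by norm_num)).const_mul _
  rw [← ofReal_integral_norm_eq_lintegral_enorm hDi]
  refine ENNReal.ofReal_le_ofReal ?_
  -- The inequality `|y| ≤ ε / 2 + y ^ 2 / (2 * ε)` reduces the `L¹` bound to the variance, at most
  -- `n`; the second term then contributes at most `1 / (2 * ε * n) ≤ ε / 2`.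
  have hpt : ∀ z, ‖(n : ℝ)⁻¹ * D z‖ ≤ ε / 2 + (n : ℝ)⁻¹ ^ 2 / (2 * ε) * D z ^ 2 := fun z => by
    have h5 : (n : ℝ)⁻¹ ^ 2 / (2 * ε) * D z ^ 2 = ‖(n : ℝ)⁻¹ * D z‖ ^ 2 / (2 * ε) := by
      rw [Real.norm_eq_abs, sq_abs]
      ring
    rw [h5]
    have h6 : 0 ≤ (‖(n : ℝ)⁻¹ * D z‖ - ε) ^ 2 / (2 * ε) := by positivity
    have h7 : (‖(n : ℝ)⁻¹ * D z‖ - ε) ^ 2 / (2 * ε) =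
        ε / 2 + ‖(n : ℝ)⁻¹ * D z‖ ^ 2 / (2 * ε) - ‖(n : ℝ)⁻¹ * D z‖ := by
      field_simp
      ring
    linarith
  have hDsq : Integrable (fun z => (n : ℝ)⁻¹ ^ 2 / (2 * ε) * D z ^ 2) P :=
    hD2.integrable_sq.const_mul _
  calc ∫ z, ‖(n : ℝ)⁻¹ * D z‖ ∂P
      ≤ ∫ z, (ε / 2 + (n : ℝ)⁻¹ ^ 2 / (2 * ε) * D z ^ 2) ∂P :=
        integral_mono hDi.norm ((integrable_const _).add hDsq) hpt
    _ = ε / 2 + (n : ℝ)⁻¹ ^ 2 / (2 * ε) * ∫ z, D z ^ 2 ∂P := by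
        rw [integral_add (integrable_const _) hDsq, integral_const_mul]
        simp
    _ ≤ ε / 2 + (n : ℝ)⁻¹ ^ 2 / (2 * ε) * n := by gcongr
    _ ≤ ε := by
        have h8 : (n : ℝ)⁻¹ ≤ ε ^ 2 := by
          rw [inv_le_comm₀ hn0 (by positivity)]
          simpa using hn
        have h9 : (n : ℝ)⁻¹ ^ 2 / (2 * ε) * n = (n : ℝ)⁻¹ / (2 * ε) := by
          field_simp
        have h10 : (n : ℝ)⁻¹ / (2 * ε) ≤ ε / 2 := by
          rw [div_le_iff₀ (by positivity)]
          calc _ ≤ ε ^ 2 := h8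
            _ = _ := by ring
        rw [h9]
        linarith

end Independent

/-- The orbits of a skew product over a permutation `σ` which applies `T` to the coordinate selected
by `J`. -/
theorem iterate_skewEquiv_piCongrRight {X ι κ : Type*} [MeasurableSpace X] [Fintype ι] [MeasurableSpace ι]
    [DiscreteMeasurableSpace ι] [DecidableEq κ] (σ : Equiv.Perm ι) (J : ι → κ) (e : X ≃ᵐ X)
    (t : ℕ) (y : ι × (κ → X)) :
    (skewEquiv σ (fun c => MeasurableEquiv.piCongrRight fun i : κ =>
      if i = J c then e else MeasurableEquiv.refl X))^[t] y =
      (σ^[t] y.1, fun i =>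
        e^[((Finset.range t).filter fun s => J (σ^[s] y.1) = i).card] (y.2 i)) := by
  induction t with
  | zero => simp
  | succ t ih =>
    rw [Function.iterate_succ_apply', ih, skewEquiv_apply]
    refine Prod.ext (Function.iterate_succ_apply' _ _ _).symm ?_
    funext i
    change (if i = J (σ^[t] y.1) then e else MeasurableEquiv.refl X)
      (e^[((Finset.range t).filter fun s => J (σ^[s] y.1) = i).card] (y.2 i)) =
      e^[((Finset.range (t + 1)).filter fun s => J (σ^[s] y.1) = i).card] (y.2 i)
    rw [Finset.range_add_one, Finset.filter_insert]
    by_cases hi : i = J (σ^[t] y.1)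
    · rw [if_pos hi, if_pos hi.symm, Finset.card_insert_of_notMem (by simp),
        Function.iterate_succ_apply']
    · rw [if_neg hi, if_neg (Ne.symm hi)]
      rfl

/-! ### Density of the two classes of maps -/

namespace MPMap

variable {X : Type*} [MeasurableSpace X] {μ : Measure X} [StandardBorelSpace X]
  [IsProbabilityMeasure μ] [NullSingletonClass μ]

/-- The maps which fix pointwise a part of positive measure of a given set are dense. -/
theorem dense_setOf_exists_fixed {C : Set X} (hC : MeasurableSet C) (hμC : μ C ≠ 0) :
    Dense {S : MPMap μ | ∃ E ⊆ C, μ E ≠ 0 ∧ ∀ x ∈ E, S x = x} := by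
  intro T
  refine mem_closure_of_forall_finset fun F n => ?_
  -- The model has `n + 1` copies of `X`, with the identity on copy `0` and `T` on the others; the
  -- projection to `X` fails to intertwine with `T` at most on copy `0`.
  let g : Fin (n + 1) → X ≃ᵐ X := fun i => if i = 0 then MeasurableEquiv.refl X else T.1
  have hg : ∀ i, MeasurePreserving (g i) μ μ := fun i => by
    by_cases hi : i = 0
    · simp only [g, if_pos hi]
      exact MeasurePreserving.id μ
    · simp only [g, if_neg hi]
      exact T.2
  let S : MPMap ((finiteUniform (Fin (n + 1))).prod μ) :=
    ⟨skewEquiv 1 g, measurePreserving_skewEquiv 1 hg⟩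
  have hSapp : ∀ y : Fin (n + 1) × X, S y = (y.1, g y.1 y.2) := fun y => rfl
  have hunif : finiteUniform (Fin (n + 1)) {0} = ((n : ℝ≥0∞) + 1)⁻¹ := by
    have := finiteUniform_apply (ι := Fin (n + 1)) {0}
    simpa using this
  have hbad : (finiteUniform (Fin (n + 1))).prod μ {y | (S y).2 ≠ T y.2} ≤ (n : ℝ≥0∞)⁻¹ := by
    calc _ ≤ (finiteUniform (Fin (n + 1))).prod μ ({0} ×ˢ univ) := by
          refine measure_mono fun y hy => ⟨?_, mem_univ _⟩
          by_contra h0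
          have h0' : ¬ y.1 = 0 := h0
          refine hy ?_
          simp only [hSapp, g, if_neg h0']
      _ = ((n : ℝ≥0∞) + 1)⁻¹ := by rw [Measure.prod_prod, hunif, measure_univ, mul_one]
      _ ≤ (n : ℝ≥0∞)⁻¹ := ENNReal.inv_le_inv.2 le_self_add
  obtain ⟨Φ, hΦ, hΦC, hΦF⟩ := exists_conj_close T S measurePreserving_snd hbad F hC
  -- The part of copy `0` over `C` is fixed exactly; the intersection with `C` is needed because `C`
  -- is matched only up to a null set.
  refine ⟨conj Φ hΦ S, ⟨C ∩ Φ ⁻¹' ({0} ×ˢ C), inter_subset_left, ?_, ?_⟩, hΦF⟩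
  · have h1 : μ (C ∩ Φ ⁻¹' ({0} ×ˢ C)) = μ (Φ ⁻¹' ({0} ×ˢ C)) := by
      refine measure_congr ?_
      filter_upwards [hΦC] with x hx
      refine propext ⟨fun h => h.2, fun h => ⟨hx.1 h.2, h⟩⟩
    rw [h1, hΦ.measure_preimage ((measurableSet_singleton _).prod hC).nullMeasurableSet,
      Measure.prod_prod, hunif]
    exact mul_ne_zero (ENNReal.inv_ne_zero.2 (by finiteness)) hμC
  · rintro x ⟨-, hx0, -⟩
    refine Φ.injective ?_
    have hx0' : (Φ x).1 = 0 := hx0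
    rw [apply_conj, hSapp]
    ext1
    · rfl
    · simp [g, hx0']

/-- The maps for which some ergodic average of a given indicator function is close to its mean are
dense. -/
theorem dense_setOf_exists_birkhoffAverage_close {A : Set X} (hA : MeasurableSet A) {ε : ℝ}
    (hε : 0 < ε) :
    Dense {S : MPMap μ | ∃ N, 0 < N ∧ ∫⁻ x, ‖birkhoffAverage ℝ S (A.indicator fun _ => (1 : ℝ)) N x
      - μ.real A‖ₑ ∂μ ≤ ENNReal.ofReal ε} := by
  intro T
  refine mem_closure_of_forall_finset fun F k => ?_
  obtain ⟨n', hn'⟩ := exists_nat_ge (1 / ε ^ 2)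
  -- The block length `m` controls the distance to `T`, while the number `n` of coordinates is
  -- dictated by the law of large numbers. The two are chosen independently.
  let m := k + 1
  let n := n' + 1
  have hn : 1 / ε ^ 2 ≤ (n : ℝ) := hn'.trans (by simp [n])
  have hm0 : (m : ℝ) ≠ 0 := by positivity
  have : NeZero (n * m) := ⟨mul_ne_zero (NeZero.ne n) (NeZero.ne m)⟩
  let ι := ZMod (n * m)
  let : MeasurableSpace ι := ⊤
  have : DiscreteMeasurableSpace ι := ⟨fun _ => trivial⟩
  let J : ι → Fin n := clock n m
  let σ : Equiv.Perm ι := Equiv.addRight 1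
  have hσ : ∀ (t : ℕ) (c : ι), σ^[t] c = c + t := fun t c => by
    induction t with
    | zero => simp
    | succ t ih =>
      rw [Function.iterate_succ_apply', ih]
      simp [σ, add_assoc]
  -- At each tick `T` acts on the coordinate selected by the clock and the others rest. Reading the
  -- selected coordinate by `π` intertwines `S` with `T` except possibly when the clock switches.
  let g : ι → (Fin n → X) ≃ᵐ (Fin n → X) := fun c =>
    MeasurableEquiv.piCongrRight fun i => if i = J c then T.1 else MeasurableEquiv.refl X
  let P : Measure (Fin n → X) := Measure.pi fun _ => μ
  let ν : Measure (ι × (Fin n → X)) := (finiteUniform ι).prod P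
  have hg : ∀ c, MeasurePreserving (g c) P P := fun c => by
    refine measurePreserving_pi (fun _ => μ) (fun _ => μ)
      (f := fun i => ⇑(if i = J c then T.1 else MeasurableEquiv.refl X)) fun i => ?_
    by_cases hi : i = J c
    · simp only [if_pos hi]
      exact T.2
    · simp only [if_neg hi]
      exact MeasurePreserving.id μ
  let S : MPMap ν := ⟨skewEquiv σ g, measurePreserving_skewEquiv σ hg⟩
  let π : ι × (Fin n → X) → X := fun y => y.2 (J y.1)
  have hπ : MeasurePreserving π ν μ :=
    (measurePreserving_snd (μ := finiteUniform ι) (ν := μ)).comp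
      ((MeasurePreserving.id (finiteUniform ι)).skew_product (μc := P) (μd := μ)
        (g := fun c z => z (J c))
        (measurable_from_prod_countable_right fun c => measurable_pi_apply (J c))
        (Eventually.of_forall fun c => (measurePreserving_eval (fun _ => μ) (J c)).map_eq))
  have hbad : ν {y | π (S y) ≠ T (π y)} ≤ (k : ℝ≥0∞)⁻¹ := by
    let B : Finset ι := Finset.univ.filter fun c : ZMod (n * m) => m ∣ c.val + 1
    calc ν {y | π (S y) ≠ T (π y)} ≤ ν ((B : Set ι) ×ˢ univ) := by
          refine measure_mono fun y hy => ⟨?_, mem_univ _⟩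
          by_contra hB
          have hB' : ¬ m ∣ ZMod.val (n := n * m) y.1 + 1 := by simpa [B] using hB
          refine hy ?_
          have hJ : J (y.1 + 1) = J y.1 := clock_add_one_of_not_dvd n m hB'
          change (if J (y.1 + 1) = J y.1 then T.1 else MeasurableEquiv.refl X)
            (y.2 (J (y.1 + 1))) = T (y.2 (J y.1))
          rw [if_pos hJ, hJ]
      _ = (Fintype.card ι : ℝ≥0∞)⁻¹ * B.card := by
          rw [Measure.prod_prod, finiteUniform_apply, measure_univ, mul_one]
      _ ≤ ((n * m : ℕ) : ℝ≥0∞)⁻¹ * n := by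
          rw [ZMod.card]
          gcongr
          exact card_dvd_val_add_one_le n m
      _ = (m : ℝ≥0∞)⁻¹ := by
          rw [Nat.cast_mul, ENNReal.mul_inv (by simp) (by simp), mul_comm, ← mul_assoc,
            ENNReal.mul_inv_cancel (by simp [n]) (by simp), one_mul]
      _ ≤ (k : ℝ≥0∞)⁻¹ := ENNReal.inv_le_inv.2 (by simp [m])
  obtain ⟨Φ, hΦ, hΦA, hΦF⟩ := exists_conj_close T S hπ hbad F hA
  refine ⟨conj Φ hΦ S, ⟨n * m, Nat.pos_of_ne_zero (NeZero.ne _), ?_⟩, hΦF⟩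
  set f : X → ℝ := A.indicator fun _ => 1 with hf
  have hfm : Measurable f := measurable_const.indicator hA
  have hf0 : ∀ x, 0 ≤ f x := fun x => indicator_nonneg (fun _ _ => zero_le_one) x
  have hf1 : ∀ x, f x ≤ 1 := fun x => indicator_le_self' (fun _ _ => zero_le_one) x
  have hfi : Integrable f μ := (integrable_const 1).indicator hA
  let h : X → ℝ := fun x => (m : ℝ)⁻¹ * ∑ i ∈ Finset.range m, f (T^[i] x)
  have hhm : Measurable h :=
    (Finset.measurable_fun_sum _ fun i _ => hfm.comp (T.measurable.iterate i)).const_mul _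
  have hh0 : ∀ x, 0 ≤ h x := fun x =>
    mul_nonneg (by positivity) (Finset.sum_nonneg fun i _ => hf0 _)
  have hh1 : ∀ x, h x ≤ 1 := fun x => by
    have h2 : ∑ i ∈ Finset.range m, f (T^[i] x) ≤ m := by
      simpa using Finset.sum_le_card_nsmul (Finset.range m) (fun i => f (T^[i] x)) 1
        fun i _ => hf1 _
    have h3 : (m : ℝ)⁻¹ * ∑ i ∈ Finset.range m, f (T^[i] x) ≤ (m : ℝ)⁻¹ * m := by gcongr
    rwa [inv_mul_cancel₀ hm0] at h3
  have hhint : ∫ x, h x ∂μ = μ.real A := by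
    have h4 : ∀ i, ∫ x, f (T^[i] x) ∂μ = μ.real A := fun i => by
      have h5 := T.measurePreserving.iterate i
      rw [← integral_map (f := f) h5.measurable.aemeasurable
        (by rw [h5.map_eq]; exact hfm.aestronglyMeasurable), h5.map_eq, hf,
        integral_indicator_const _ hA]
      simp
    have h5 : ∫ x, ∑ i ∈ Finset.range m, f (T^[i] x) ∂μ =
        ∑ i ∈ Finset.range m, ∫ x, f (T^[i] x) ∂μ := integral_finsetSum _ fun i _ =>
      (T.measurePreserving.iterate i).integrable_comp_of_integrable hfi
    rw [integral_const_mul, h5]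
    simp only [h4, Finset.sum_const, Finset.card_range, nsmul_eq_mul]
    rw [← mul_assoc, inv_mul_cancel₀ hm0, one_mul]
  have hlln := lintegral_enorm_average_sub_le μ hhm hh0 hh1 n hε hn
  rw [hhint] at hlln
  -- In one period every coordinate is selected exactly `m` times, whatever the initial clock value.
  -- The orbit average is thus a mean of `n` independent copies of `h`.
  have horb : ∀ y, ((n * m : ℕ) : ℝ)⁻¹ * ∑ t ∈ Finset.range (n * m), f (π (S^[t] y)) =
      (n : ℝ)⁻¹ * ∑ j : Fin n, h (y.2 j) := fun y => by
    have h6 : ∀ t, f (π (S^[t] y)) = f (T^[((Finset.range t).filter fun s : ℕ =>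
        J (y.1 + s) = J (y.1 + t)).card] (y.2 (J (y.1 + t)))) := fun t => by
      have h7 := iterate_skewEquiv_piCongrRight σ J T.1 t y
      have h8 : S^[t] y = _ := h7
      simp only [h8, π, hσ]
    simp only [h6]
    rw [sum_range_occurrences (fun t : ℕ => J (y.1 + t)) fun j i => f (T^[i] (y.2 j))]
    have h9 : ∀ j, ((Finset.range (n * m)).filter fun s : ℕ => J (y.1 + s) = j).card = m :=
      fun j => card_clock_eq n m y.1 j
    simp only [h9, h, ← Finset.mul_sum]
    rw [Nat.cast_mul, mul_inv, mul_assoc]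
  have hae : ∀ᵐ x ∂μ, birkhoffAverage ℝ (conj Φ hΦ S) f (n * m) x =
      (n : ℝ)⁻¹ * ∑ j : Fin n, h ((Φ x).2 j) := by
    have h10 : ∀ t : ℕ, ∀ᵐ x ∂μ, f ((conj Φ hΦ S)^[t] x) = f (π (S^[t] (Φ x))) := fun t => by
      filter_upwards [((conj Φ hΦ S).measurePreserving.iterate t).quasiMeasurePreserving.ae hΦA]
        with x hx
      rw [apply_conj_iterate] at hx
      by_cases hx' : (conj Φ hΦ S)^[t] x ∈ A
      · rw [hf, indicator_of_mem hx', indicator_of_mem (hx.2 hx')]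
      · rw [hf, indicator_of_notMem hx', indicator_of_notMem fun h => hx' (hx.1 h)]
    filter_upwards [ae_all_iff.2 h10] with x hx
    rw [← horb, birkhoffAverage, birkhoffSum, smul_eq_mul]
    simp only [hx]
  calc ∫⁻ x, ‖birkhoffAverage ℝ (conj Φ hΦ S) f (n * m) x - μ.real A‖ₑ ∂μ
      = ∫⁻ x, ‖(n : ℝ)⁻¹ * ∑ j : Fin n, h ((Φ x).2 j) - μ.real A‖ₑ ∂μ := by
        refine lintegral_congr_ae ?_
        filter_upwards [hae] with x hx
        rw [hx]
    _ = ∫⁻ z, ‖(n : ℝ)⁻¹ * ∑ j : Fin n, h (z j) - μ.real A‖ₑ ∂P := by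
        have hsnd : MeasurePreserving (fun x => (Φ x).2) μ P :=
          (measurePreserving_snd (μ := finiteUniform ι) (ν := P)).comp hΦ
        refine hsnd.lintegral_comp (f := fun z =>
          ‖(n : ℝ)⁻¹ * ∑ j : Fin n, h (z j) - μ.real A‖ₑ) ?_
        exact (((Finset.measurable_fun_sum _ fun j _ =>
          hhm.comp (measurable_pi_apply j)).const_mul _).sub_const _).enorm
    _ ≤ ENNReal.ofReal ε := hlln

end MPMap

/-! ### Ergodic averages that vanish in `L¹` -/

section IteratesL1

variable {X E : Type*} [MeasurableSpace X] [NormedAddCommGroup E] {μ : Measure X} {T : X → X}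

theorem lintegral_comp_iterate (hT : MeasurePreserving T μ μ) {u : X → E}
    (hu : AEStronglyMeasurable u μ) (k : ℕ) :
    ∫⁻ x, ‖u (T^[k] x)‖ₑ ∂μ = ∫⁻ x, ‖u x‖ₑ ∂μ := by
  have h := hT.iterate k
  have hu' := hu.enorm
  conv_rhs => rw [← h.map_eq]
  rw [← h.map_eq] at hu'
  rw [lintegral_map' hu' h.measurable.aemeasurable]

theorem lintegral_enorm_add_le {f g : X → E} (hf : AEStronglyMeasurable f μ) :
    ∫⁻ x, ‖f x + g x‖ₑ ∂μ ≤ ∫⁻ x, ‖f x‖ₑ ∂μ + ∫⁻ x, ‖g x‖ₑ ∂μ := by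
  rw [← lintegral_add_left' hf.enorm]
  exact lintegral_mono fun x => enorm_add_le _ _

theorem lintegral_enorm_sub_integral_sub_le [NormedSpace ℝ E] [IsProbabilityMeasure μ]
    {u v : X → E} (hu : Integrable u μ) (hv : Integrable v μ) :
    ∫⁻ x, ‖(u x - ∫ y, u y ∂μ) - (v x - ∫ y, v y ∂μ)‖ₑ ∂μ ≤
      ∫⁻ x, ‖u x - v x‖ₑ ∂μ + ∫⁻ x, ‖u x - v x‖ₑ ∂μ := by
  have hle : ‖∫ y, v y ∂μ - ∫ y, u y ∂μ‖ₑ ≤ ∫⁻ x, ‖u x - v x‖ₑ ∂μ := by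
    rw [← integral_sub hv hu, lintegral_enorm_sub_comm]
    exact enorm_integral_le_lintegral_enorm _
  calc ∫⁻ x, ‖(u x - ∫ y, u y ∂μ) - (v x - ∫ y, v y ∂μ)‖ₑ ∂μ
      = ∫⁻ x, ‖(u - v) x + (∫ y, v y ∂μ - ∫ y, u y ∂μ)‖ₑ ∂μ := by
        refine lintegral_congr fun x => ?_
        congr 1
        simp only [Pi.sub_apply]
        abel
    _ ≤ ∫⁻ x, ‖(u - v) x‖ₑ ∂μ + ∫⁻ _, ‖∫ y, v y ∂μ - ∫ y, u y ∂μ‖ₑ ∂μ :=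
        lintegral_enorm_add_le (hu.sub hv).aestronglyMeasurable
    _ ≤ _ := by
        rw [lintegral_const, measure_univ, mul_one]
        exact add_le_add le_rfl hle

end IteratesL1

theorem birkhoffAverage_sub_const {X E : Type*} [NormedAddCommGroup E] [NormedSpace ℝ E] {T : X → X}
    {u : X → E} (c : E) {L : ℕ} (hL : 0 < L) (x : X) :
    birkhoffAverage ℝ T (fun y => u y - c) L x = birkhoffAverage ℝ T u L x - c := by
  have hL' : (L : ℝ) ≠ 0 := by positivity
  simp only [birkhoffAverage, birkhoffSum, Finset.sum_sub_distrib, Finset.sum_const,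
    Finset.card_range, smul_sub]
  rw [← Nat.cast_smul_eq_nsmul ℝ, inv_smul_smul₀ hL']

section AverageVanish

variable {X E : Type*} [MeasurableSpace X] [NormedAddCommGroup E] [NormedSpace ℝ E]

/-- The ergodic averages of `u` under `T` tend to zero in `L¹`. -/
def AverageVanish (T : X → X) (μ : Measure X) (u : X → E) : Prop :=
  Tendsto (fun L => ∫⁻ x, ‖birkhoffAverage ℝ T u L x‖ₑ ∂μ) atTop (𝓝 0)

variable {μ : Measure X} {T : X → X}

theorem aestronglyMeasurable_birkhoffAverage (hT : MeasurePreserving T μ μ) {u : X → E}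
    (hu : AEStronglyMeasurable u μ) (L : ℕ) :
    AEStronglyMeasurable (birkhoffAverage ℝ T u L) μ := by
  have : AEStronglyMeasurable (fun x => ∑ k ∈ Finset.range L, u (T^[k] x)) μ :=
    Finset.aestronglyMeasurable_fun_sum _ fun k _ => hu.comp_measurePreserving (hT.iterate k)
  exact this.const_smul _

theorem lintegral_enorm_birkhoffAverage_le (hT : MeasurePreserving T μ μ) {u : X → E}
    (hu : AEStronglyMeasurable u μ) (L : ℕ) :
    ∫⁻ x, ‖birkhoffAverage ℝ T u L x‖ₑ ∂μ ≤ ∫⁻ x, ‖u x‖ₑ ∂μ := by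
  have hm : ∀ k, AEMeasurable (fun x => ‖u (T^[k] x)‖ₑ) μ := fun k =>
    (hu.comp_measurePreserving (hT.iterate k)).enorm
  have hL : ‖(L : ℝ)⁻¹‖ₑ * L ≤ 1 := by
    rcases Nat.eq_zero_or_pos L with rfl | hL
    · simp
    · rw [enorm_inv (by positivity), Real.enorm_natCast, ENNReal.inv_mul_cancel (by simpa using hL.ne')
        (by simp)]
  calc ∫⁻ x, ‖birkhoffAverage ℝ T u L x‖ₑ ∂μ
      ≤ ∫⁻ x, ‖(L : ℝ)⁻¹‖ₑ * ∑ k ∈ Finset.range L, ‖u (T^[k] x)‖ₑ ∂μ := by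
        refine lintegral_mono fun x => ?_
        rw [birkhoffAverage, enorm_smul]
        gcongr
        exact enorm_sum_le _ _
    _ = ‖(L : ℝ)⁻¹‖ₑ * L * ∫⁻ x, ‖u x‖ₑ ∂μ := by
        rw [lintegral_const_mul'' _ (Finset.aemeasurable_fun_sum _ fun k _ => hm k),
          lintegral_finsetSum' _ fun k _ => hm k]
        simp only [lintegral_comp_iterate hT hu, Finset.sum_const, Finset.card_range, nsmul_eq_mul,
          mul_assoc]
    _ ≤ 1 * ∫⁻ x, ‖u x‖ₑ ∂μ := by gcongr
    _ = ∫⁻ x, ‖u x‖ₑ ∂μ := one_mul _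

theorem AverageVanish.add (hT : MeasurePreserving T μ μ) {u v : X → E}
    (hu : AverageVanish T μ u) (hv : AverageVanish T μ v) (hum : AEStronglyMeasurable u μ) :
    AverageVanish T μ (u + v) := by
  refine tendsto_of_tendsto_of_tendsto_of_le_of_le tendsto_const_nhds
    (by simpa using Tendsto.add hu hv) (fun _ => zero_le) fun L => ?_
  rw [birkhoffAverage_add]
  exact lintegral_enorm_add_le (aestronglyMeasurable_birkhoffAverage hT hum L)

/-- Averaging is a contraction of `L¹`, so the functions with vanishing averages form a closed set.
-/
theorem AverageVanish.of_approx (hT : MeasurePreserving T μ μ) {u : X → E}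
    (hu : AEStronglyMeasurable u μ)
    (h : ∀ ε : ℝ≥0∞, 0 < ε → ∃ v : X → E, AEStronglyMeasurable v μ ∧ AverageVanish T μ v ∧
      ∫⁻ x, ‖u x - v x‖ₑ ∂μ ≤ ε) : AverageVanish T μ u := by
  refine ENNReal.tendsto_nhds_zero.2 fun ε hε => ?_
  have hε2 : 0 < ε / 2 := ENNReal.half_pos hε.ne'
  obtain ⟨v, hvm, hv, huv⟩ := h (ε / 2) hε2
  filter_upwards [ENNReal.tendsto_nhds_zero.1 hv (ε / 2) hε2] with L hL
  have huvm : AEStronglyMeasurable (u - v) μ := hu.sub hvm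
  have hsplit : u = (u - v) + v := by simp
  calc ∫⁻ x, ‖birkhoffAverage ℝ T u L x‖ₑ ∂μ
      ≤ ∫⁻ x, ‖birkhoffAverage ℝ T (u - v) L x‖ₑ ∂μ + ∫⁻ x, ‖birkhoffAverage ℝ T v L x‖ₑ ∂μ := by
        conv_lhs => rw [hsplit, birkhoffAverage_add]
        exact lintegral_enorm_add_le (aestronglyMeasurable_birkhoffAverage hT huvm L)
    _ ≤ ε / 2 + ε / 2 :=
        add_le_add ((lintegral_enorm_birkhoffAverage_le hT huvm L).trans huv) hL
    _ = ε := ENNReal.add_halves ε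

theorem AverageVanish.const_smul {u : X → E} (hu : AverageVanish T μ u) (c : ℝ) :
    AverageVanish T μ (c • u) := by
  have h := ENNReal.Tendsto.const_mul (a := ‖c‖ₑ) hu (Or.inr enorm_ne_top)
  rw [mul_zero] at h
  refine h.congr fun L => ?_
  rw [← lintegral_const_mul' _ _ enorm_ne_top]
  refine lintegral_congr fun x => ?_
  rw [← enorm_smul]
  congr 1
  exact map_birkhoffAverage ℝ ℝ (LinearMap.lsmul ℝ E c) T u L x

/-- The averages of a coboundary tend to zero. -/
theorem averageVanish_comp_sub (hT : MeasurePreserving T μ μ) {u : X → E} (hu : Integrable u μ) :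
    AverageVanish T μ (fun x => u (T x) - u x) := by
  have hI : ∫⁻ x, ‖u x‖ₑ ∂μ ≠ ∞ := hu.2.ne
  have h1 : Tendsto (fun L : ℕ => (L : ℝ≥0∞)⁻¹ * (∫⁻ x, ‖u x‖ₑ ∂μ + ∫⁻ x, ‖u x‖ₑ ∂μ))
      atTop (𝓝 0) := by
    have := ENNReal.Tendsto.mul_const ENNReal.tendsto_inv_nat_nhds_zero
      (b := ∫⁻ x, ‖u x‖ₑ ∂μ + ∫⁻ x, ‖u x‖ₑ ∂μ) (Or.inr (by finiteness))
    simpa using this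
  refine tendsto_of_tendsto_of_tendsto_of_le_of_le' tendsto_const_nhds h1
    (Eventually.of_forall fun _ => zero_le) ?_
  filter_upwards [eventually_gt_atTop 0] with L hL
  have h2 : ∀ x, birkhoffAverage ℝ T (fun x => u (T x) - u x) L x =
      (L : ℝ)⁻¹ • (u (T^[L] x) - u x) := fun x => by
    rw [← birkhoffAverage_apply_sub_birkhoffAverage]
    have : (fun x => u (T x) - u x) = u ∘ T - u := rfl
    rw [this, birkhoffAverage_sub]
    simp only [Pi.sub_apply, birkhoffAverage, birkhoffSum, Function.comp,
      ← Function.iterate_succ_apply', Function.iterate_succ_apply]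
  simp only [h2, enorm_smul]
  rw [lintegral_const_mul' _ _ enorm_ne_top, enorm_inv (by positivity), Real.enorm_natCast]
  gcongr
  have hm : AEMeasurable (fun x => ‖u (T^[L] x)‖ₑ) μ :=
    (hu.aestronglyMeasurable.comp_measurePreserving (hT.iterate L)).enorm
  calc ∫⁻ x, ‖u (T^[L] x) - u x‖ₑ ∂μ ≤ ∫⁻ x, (‖u (T^[L] x)‖ₑ + ‖u x‖ₑ) ∂μ :=
        lintegral_mono fun x => enorm_sub_le
    _ = ∫⁻ x, ‖u x‖ₑ ∂μ + ∫⁻ x, ‖u x‖ₑ ∂μ := by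
        rw [lintegral_add_left' hm, lintegral_comp_iterate hT hu.aestronglyMeasurable L]

theorem averageVanish_iterate_sub (hT : MeasurePreserving T μ μ) {u : X → E}
    (hu : Integrable u μ) (k : ℕ) : AverageVanish T μ (fun x => u (T^[k] x) - u x) := by
  induction k with
  | zero => simp [AverageVanish, birkhoffAverage, birkhoffSum]
  | succ k ih =>
    have hk := (hT.iterate k).integrable_comp_of_integrable hu
    have h := averageVanish_comp_sub hT hk
    have := h.add hT ih ((hT.integrable_comp_of_integrable hk).sub hk).aestronglyMeasurable
    refine this.congr fun L => ?_
    congr! 4 with x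
    funext x
    simp [Function.iterate_succ_apply]

/-- If the averages of `u` get small in `L¹`, then they tend to zero. -/
theorem averageVanish_of_exists (hT : MeasurePreserving T μ μ) {u : X → E} (hu : Integrable u μ)
    (h : ∀ ε : ℝ≥0∞, 0 < ε → ∃ N, 0 < N ∧ ∫⁻ x, ‖birkhoffAverage ℝ T u N x‖ₑ ∂μ ≤ ε) :
    AverageVanish T μ u := by
  refine .of_approx hT hu.aestronglyMeasurable fun ε hε => ?_
  obtain ⟨N, hN, hNε⟩ := h ε hε
  have hsub : ∀ k, AEStronglyMeasurable (fun x => u (T^[k] x) - u x) μ := fun k =>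
    (hu.aestronglyMeasurable.comp_measurePreserving (hT.iterate k)).sub hu.aestronglyMeasurable
  have hsum : ∀ M : ℕ, AEStronglyMeasurable
      (∑ k ∈ Finset.range M, fun x => u (T^[k] x) - u x) μ ∧
      AverageVanish T μ (∑ k ∈ Finset.range M, fun x => u (T^[k] x) - u x) := fun M => by
    induction M with
    | zero => simp [AverageVanish, birkhoffAverage, birkhoffSum, aestronglyMeasurable_zero]
    | succ M ih =>
      rw [Finset.sum_range_succ]
      exact ⟨ih.1.add (hsub M), ih.2.add hT (averageVanish_iterate_sub hT hu M) ih.1⟩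
  -- This combination of coboundaries equals `u` minus its `N`-th average, so its distance from `u`
  -- is the norm of that average, at most `ε`.
  refine ⟨(-(N : ℝ)⁻¹) • ∑ k ∈ Finset.range N, fun x => u (T^[k] x) - u x,
    (hsum N).1.const_smul _, (hsum N).2.const_smul _, ?_⟩
  refine le_trans (le_of_eq (lintegral_congr fun x => ?_)) hNε
  congr 1
  have hN' : (N : ℝ) ≠ 0 := by positivity
  simp only [Pi.smul_apply, Finset.sum_apply, Finset.sum_sub_distrib, Finset.sum_const,
    Finset.card_range, birkhoffAverage, birkhoffSum, smul_sub, neg_smul]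
  rw [← Nat.cast_smul_eq_nsmul ℝ, inv_smul_smul₀ hN']
  abel

/-- If the averages of centred indicator functions vanish for a dense family of sets, then those of
all centred integrable functions do. -/
theorem averageVanish_sub_integral [CompleteSpace E] [IsProbabilityMeasure μ]
    (hT : MeasurePreserving T μ μ) {𝒜 : Set (Set X)} (h𝒜 : μ.MeasureDense 𝒜)
    (h : ∀ A ∈ 𝒜, AverageVanish T μ fun x => A.indicator (fun _ => (1 : ℝ)) x - μ.real A)
    {g : X → E} (hg : Integrable g μ) : AverageVanish T μ fun x => g x - ∫ y, g y ∂μ := by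
  have hset : ∀ A, MeasurableSet A →
      AverageVanish T μ fun x => A.indicator (fun _ => (1 : ℝ)) x - μ.real A := by
    intro A hA
    have hind : ∀ {B}, MeasurableSet B → Integrable (B.indicator fun _ => (1 : ℝ)) μ :=
      fun hB => (integrable_const 1).indicator hB
    refine .of_approx hT ((hind hA).sub (integrable_const _)).aestronglyMeasurable fun ε hε => ?_
    obtain ⟨r, hr0, hr⟩ := ENNReal.lt_iff_exists_nnreal_btwn.1 (ENNReal.half_pos hε.ne')
    obtain ⟨B, hB, hAB⟩ := h𝒜.approx A hA (measure_ne_top _ _) r (by exact_mod_cast hr0)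
    have hBm := h𝒜.measurable B hB
    refine ⟨_, ((hind hBm).sub (integrable_const _)).aestronglyMeasurable, h B hB, ?_⟩
    have h1 := lintegral_enorm_sub_integral_sub_le (hind hA) (hind hBm)
    simp only [integral_indicator_const _ hA, integral_indicator_const _ hBm, smul_eq_mul,
      mul_one] at h1
    have h3 : ∫⁻ x, ‖A.indicator (fun _ => (1 : ℝ)) x - B.indicator (fun _ => (1 : ℝ)) x‖ₑ ∂μ =
        μ (A ∆ B) := by
      rw [← lintegral_indicator_one (hA.symmDiff hBm)]
      refine lintegral_congr fun x => ?_
      by_cases h1 : x ∈ A <;> by_cases h2 : x ∈ B <;> simp [h1, h2, Set.mem_symmDiff]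
    rw [h3] at h1
    rw [ENNReal.ofReal_coe_nnreal] at hAB
    calc _ ≤ μ (A ∆ B) + μ (A ∆ B) := h1
      _ ≤ ε / 2 + ε / 2 := add_le_add (hAB.le.trans hr.le) (hAB.le.trans hr.le)
      _ = ε := ENNReal.add_halves ε
  refine Integrable.induction (P := fun g : X → E => AverageVanish T μ fun x => g x - ∫ y, g y ∂μ)
    ?_ ?_ ?_ ?_ hg
  · intro c A hA _
    have h1 := ENNReal.Tendsto.const_mul (a := ‖c‖ₑ) (hset A hA) (Or.inr enorm_ne_top)
    rw [mul_zero] at h1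
    refine h1.congr fun L => ?_
    rw [← lintegral_const_mul' _ _ enorm_ne_top]
    refine lintegral_congr fun x => ?_
    rw [mul_comm, ← enorm_smul]
    congr 1
    refine (map_birkhoffAverage ℝ ℝ ((LinearMap.id : ℝ →ₗ[ℝ] ℝ).smulRight c) T _ L x).trans ?_
    congr 1
    funext y
    rw [integral_indicator_const _ hA]
    by_cases hy : y ∈ A <;> simp [hy, sub_smul]
  · intro u v _ hu hv h1 h2
    have := h1.add hT h2 (hu.sub (integrable_const _)).aestronglyMeasurable
    refine this.congr fun L => ?_
    congr! 4 with x
    funext x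
    simp only [Pi.add_apply, integral_add hu hv]
    abel
  · refine isClosed_of_closure_subset fun u hu => ?_
    have hui := L1.integrable_coeFn u
    refine AverageVanish.of_approx hT (hui.sub (integrable_const _)).aestronglyMeasurable
      fun ε hε => ?_
    obtain ⟨v, hv, huv⟩ := EMetric.mem_closure_iff.1 hu (ε / 2) (ENNReal.half_pos hε.ne')
    have hvi := L1.integrable_coeFn v
    refine ⟨_, (hvi.sub (integrable_const _)).aestronglyMeasurable, hv, ?_⟩
    rw [L1.edist_def] at huv
    simp only [edist_eq_enorm_sub] at huv
    refine (lintegral_enorm_sub_integral_sub_le hui hvi).trans ?_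
    exact (add_le_add huv.le huv.le).trans (ENNReal.add_halves ε).le
  · intro u v huv hu h1
    have hint := integral_congr_ae huv
    refine h1.congr fun L => lintegral_congr_ae ?_
    have : ∀ᵐ x ∂μ, ∀ k, u (T^[k] x) = v (T^[k] x) :=
      ae_all_iff.2 fun k => (hT.iterate k).quasiMeasurePreserving.ae huv
    filter_upwards [this] with x hx
    simp only [birkhoffAverage, birkhoffSum, hx, hint]

/-- A map for which the averages of centred indicator functions vanish is ergodic. -/
theorem ergodic_of_averageVanish [IsProbabilityMeasure μ] (hT : MeasurePreserving T μ μ)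
    (h : ∀ A, MeasurableSet A →
      AverageVanish T μ fun x => A.indicator (fun _ => (1 : ℝ)) x - μ.real A) : Ergodic T μ := by
  refine ⟨hT, ⟨fun {s} hs hTs => ?_⟩⟩
  rw [eventuallyConst_set']
  set u : X → ℝ := fun x => s.indicator (fun _ => (1 : ℝ)) x - μ.real s with hu
  have hum : Measurable u := (measurable_const.indicator hs).sub_const _
  have huT : u ∘ T = u := by
    funext x
    have : T x ∈ s ↔ x ∈ s := by rw [← mem_preimage, hTs]
    by_cases hx : x ∈ s
    · simp [hu, hx, this.2 hx]
    · simp [hu, hx, mt this.1 hx]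
  -- For an invariant set the averages of `u` are `u` itself, so their vanishing forces the
  -- indicator to be constant almost everywhere.
  have h0 : ∫⁻ x, ‖u x‖ₑ ∂μ = 0 := by
    refine tendsto_nhds_unique (tendsto_const_nhds.congr' ?_) (h s hs)
    filter_upwards [eventually_gt_atTop 0] with L hL
    rw [← hu, birkhoffAverage_of_comp_eq ℝ huT (by positivity)]
  rw [lintegral_eq_zero_iff hum.enorm] at h0
  by_cases hs0 : μ s = 0
  · exact Or.inl (ae_eq_empty.2 hs0)
  · right
    have hs' : μ.real s ≠ 0 := by simpa [Measure.real, ENNReal.toReal_eq_zero_iff] using hs0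
    rw [ae_eq_univ]
    refine measure_eq_zero_iff_ae_notMem.2 ?_
    filter_upwards [h0] with x hx hxs
    have hxs' : x ∉ s := hxs
    simp [hu, hxs', hs'] at hx

end AverageVanish

/-! ### Covering almost every point infinitely often by shifted sets -/

section Hitting

variable {X : Type*} [MeasurableSpace X] {μ : Measure X} [IsProbabilityMeasure μ] {T : X → X}

/-- If the averages of centred indicators vanish, then some preimage of `E` carries at least half of
the mass of `h` expected under independence. -/
theorem exists_iterate_integral_ge (hT : MeasurePreserving T μ μ) {h : X → ℝ} (hm : Measurable h)
    (h0 : ∀ x, 0 ≤ h x) (h2 : ∀ x, h x ≤ 2) {E : Set X} (hE : MeasurableSet E)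
    (hav : AverageVanish T μ fun x => E.indicator (fun _ => (1 : ℝ)) x - μ.real E) :
    ∃ k : ℕ, (∫ x, h x ∂μ) * μ.real E / 2 ≤
      ∫ x, h x * E.indicator (fun _ => (1 : ℝ)) (T^[k] x) ∂μ := by
  by_contra! hcon
  set φ : X → ℝ := E.indicator fun _ => (1 : ℝ) with hφ
  have hφm : Measurable φ := measurable_const.indicator hE
  have hφ0 : ∀ x, 0 ≤ φ x := fun x => indicator_nonneg (fun _ _ => zero_le_one) x
  have hφ1 : ∀ x, φ x ≤ 1 := fun x => indicator_le_self' (fun _ _ => zero_le_one) x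
  have hhi : Integrable h μ := Integrable.of_bound hm.aestronglyMeasurable 2
    (Eventually.of_forall fun x => by rw [Real.norm_eq_abs, abs_of_nonneg (h0 x)]; exact h2 x)
  have hhφ : ∀ k, Integrable (fun x => h x * φ (T^[k] x)) μ := fun k => by
    refine Integrable.of_bound
      (hm.mul (hφm.comp (hT.measurable.iterate k))).aestronglyMeasurable 2
      (Eventually.of_forall fun x => ?_)
    rw [Real.norm_eq_abs, abs_of_nonneg (mul_nonneg (h0 x) (hφ0 _))]
    exact (mul_le_of_le_one_right (h0 x) (hφ1 _)).trans (h2 x)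
  set c := (∫ x, h x ∂μ) * μ.real E with hc
  have hc0 : 0 < c := by
    -- The negated claim at `k = 0` bounds a nonnegative integral strictly by `c / 2`, so `c` is
    -- positive.
    have h3 : 0 ≤ ∫ x, h x * φ (T^[0] x) ∂μ :=
      integral_nonneg fun x => mul_nonneg (h0 x) (hφ0 _)
    linarith [hcon 0]
  -- Since `h ≤ 2`, an average of norm below `c / 4` changes the integral against `h` by less than
  -- `c / 2`. If every `k` failed, the change would be at least `c / 2`.
  have hev := (hav.eventually_lt_const (u := ENNReal.ofReal (c / 4))
    (by simpa using hc0)).and (eventually_gt_atTop 0)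
  obtain ⟨L, hL, hL0⟩ := hev.exists
  have hL' : (0 : ℝ) < L := by exact_mod_cast hL0
  set u : X → ℝ := fun x => φ x - μ.real E with hu
  have hum : AEStronglyMeasurable (birkhoffAverage ℝ T u L) μ :=
    aestronglyMeasurable_birkhoffAverage hT (hφm.sub_const _).aestronglyMeasurable L
  have hui : Integrable (birkhoffAverage ℝ T u L) μ := by
    refine ⟨hum, ?_⟩
    exact hL.trans ENNReal.ofReal_lt_top
  have hsmall : ∫ x, ‖birkhoffAverage ℝ T u L x‖ ∂μ < c / 4 := by
    rw [← ofReal_integral_norm_eq_lintegral_enorm hui] at hL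
    exact (ENNReal.ofReal_lt_ofReal_iff (by linarith)).1 hL
  have hform : ∀ x, h x * birkhoffAverage ℝ T u L x =
      (L : ℝ)⁻¹ * ∑ k ∈ Finset.range L, h x * φ (T^[k] x) - h x * μ.real E := fun x => by
    rw [hu, birkhoffAverage_sub_const _ hL0, birkhoffAverage, birkhoffSum, smul_eq_mul, mul_sub,
      ← Finset.mul_sum]
    ring
  have hint : ∫ x, h x * birkhoffAverage ℝ T u L x ∂μ ≤ -(c / 2) := by
    simp only [hform]
    rw [integral_sub ((integrable_finsetSum _ fun k _ => hhφ k).const_mul _)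
      (hhi.mul_const _), integral_const_mul, integral_finsetSum _ fun k _ => hhφ k,
      integral_mul_const, ← hc]
    have h4 : ∑ k ∈ Finset.range L, ∫ x, h x * φ (T^[k] x) ∂μ ≤ L * (c / 2) := by
      simpa using Finset.sum_le_card_nsmul (Finset.range L) _ (c / 2) fun k _ => (hcon k).le
    have h5 : (L : ℝ)⁻¹ * ∑ k ∈ Finset.range L, ∫ x, h x * φ (T^[k] x) ∂μ ≤
        (L : ℝ)⁻¹ * (L * (c / 2)) := by gcongr
    rw [inv_mul_cancel_left₀ hL'.ne'] at h5
    linarith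
  have habs : -∫ x, h x * birkhoffAverage ℝ T u L x ∂μ ≤
      2 * ∫ x, ‖birkhoffAverage ℝ T u L x‖ ∂μ := by
    rw [← integral_const_mul]
    refine (neg_le_abs _).trans (abs_integral_le_integral_abs.trans ?_)
    refine integral_mono_of_nonneg (Eventually.of_forall fun x => abs_nonneg _)
      (hui.norm.const_mul 2) (Eventually.of_forall fun x => ?_)
    simp only [abs_mul]
    rw [abs_of_nonneg (h0 x)]
    exact mul_le_mul_of_nonneg_right (h2 x) (abs_nonneg _)
  linarith

/-- If `a` stayed above `η`, each step would lose at least `η * e n / 2` up to a summable gain, and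
divergence of the sum of `e` would make `a` negative. -/
theorem exists_lt_of_recursive_le {a b e : ℕ → ℝ} (ha : ∀ n, 0 ≤ a n) (he0 : ∀ n, 0 ≤ e n)
    (hb : Summable b) (he : ¬ Summable e) (hb0 : ∀ n, 0 ≤ b n)
    (h : ∀ n, a (n + 1) ≤ a n - a n * e n / 2 + b n) {η : ℝ} (hη : 0 < η) (m : ℕ) :
    ∃ n ≥ m, a n < η := by
  by_contra! hcon
  have hind : ∀ N, a (m + N) ≤ a m - η / 2 * ∑ i ∈ Finset.range N, e (i + m) +
      ∑ i ∈ Finset.range N, b (i + m) := fun N => by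
    induction N with
    | zero => simp
    | succ N ih =>
      rw [Finset.sum_range_succ, Finset.sum_range_succ, add_comm N m]
      have h1 := h (m + N)
      have h2 := mul_le_mul_of_nonneg_right (hcon (m + N) (Nat.le_add_right _ _)) (he0 (m + N))
      rw [← add_assoc]
      linarith
  have he' : ¬ Summable fun i => e (i + m) := fun hs => he ((summable_nat_add_iff m).1 hs)
  have htend := (not_summable_iff_tendsto_nat_atTop_of_nonneg fun i => he0 (i + m)).1 he'
  have hb' : Summable fun i => b (i + m) := (summable_nat_add_iff m).2 hb
  obtain ⟨N, hN⟩ := (htend.eventually_gt_atTop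
    ((a m + ∑' i, b (i + m)) / (η / 2))).exists
  rw [div_lt_iff₀ (by positivity)] at hN
  have h3 := hb'.sum_le_tsum (Finset.range N) fun i _ => hb0 (i + m)
  have h4 := hind N
  have h5 := ha (m + N)
  linarith

/-- Sets with divergent total measure can be shifted so that almost every point is covered
infinitely often. -/
theorem exists_iterates_frequently_mem (hT : MeasurePreserving T μ μ)
    (hav : ∀ A, MeasurableSet A →
      AverageVanish T μ fun x => A.indicator (fun _ => (1 : ℝ)) x - μ.real A)
    {E : ℕ → Set X} (hE : ∀ n, MeasurableSet (E n)) (hsum : ∑' n, μ (E n) = ∞) :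
    ∃ k : ℕ → ℕ, ∀ᵐ x ∂μ, ∃ᶠ n in atTop, T^[k n] x ∈ E n := by
  classical
  let φ : ℕ → X → ℝ := fun n => (E n).indicator fun _ => 1
  have hφm : ∀ n, Measurable (φ n) := fun n => measurable_const.indicator (hE n)
  have hφ0 : ∀ n x, 0 ≤ φ n x := fun n x => indicator_nonneg (fun _ _ => zero_le_one) x
  have hφ1 : ∀ n x, φ n x ≤ 1 := fun n x => indicator_le_self' (fun _ _ => zero_le_one) x
  have hex : ∀ (n : ℕ) (h : X → ℝ), ∃ k : ℕ, Measurable h → (∀ x, 0 ≤ h x) → (∀ x, h x ≤ 2) →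
      (∫ x, h x ∂μ) * μ.real (E n) / 2 ≤ ∫ x, h x * φ n (T^[k] x) ∂μ := fun n h => by
    by_cases hh : Measurable h ∧ (∀ x, 0 ≤ h x) ∧ ∀ x, h x ≤ 2
    · obtain ⟨k, hk⟩ := exists_iterate_integral_ge hT hh.1 hh.2.1 hh.2.2 (hE n) (hav _ (hE n))
      exact ⟨k, fun _ _ _ => hk⟩
    · exact ⟨0, fun h1 h2 h3 => absurd ⟨h1, h2, h3⟩ hh⟩
  choose κ hκ using hex
  -- The weight `h n` marks what remains to be covered: covering a point kills its weight, and the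
  -- term `(1 / 2) ^ (n + 1)` then restores a little everywhere. This makes one recursion yield
  -- infinitely many visits rather than a single one, at only a summable cost.
  let h : ℕ → X → ℝ := fun n => Nat.rec (fun _ => 1)
    (fun n g x => g x * (1 - φ n (T^[κ n g] x)) + (1 / 2) ^ (n + 1)) n
  have hsucc : ∀ n x, h (n + 1) x = h n x * (1 - φ n (T^[κ n (h n)] x)) + (1 / 2) ^ (n + 1) :=
    fun n x => rfl
  have hm : ∀ n, Measurable (h n) := fun n => by
    induction n with
    | zero => exact measurable_const
    | succ n ih =>
      exact (ih.mul (measurable_const.sub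
        ((hφm n).comp (hT.measurable.iterate _)))).add_const _
  have h0 : ∀ n x, 0 ≤ h n x := fun n x => by
    induction n with
    | zero => exact zero_le_one
    | succ n ih =>
      rw [hsucc]
      exact add_nonneg (mul_nonneg ih (sub_nonneg.2 (hφ1 _ _))) (by positivity)
  have h2' : ∀ n x, h n x ≤ 2 - (1 / 2) ^ n := fun n x => by
    induction n with
    | zero => norm_num [h]
    | succ n ih =>
      rw [hsucc]
      have h3 : h n x * (1 - φ n (T^[κ n (h n)] x)) ≤ h n x :=
        mul_le_of_le_one_right (h0 n x) (by linarith [hφ0 n (T^[κ n (h n)] x)])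
      have h4 : ((1 : ℝ) / 2) ^ n = 2 * (1 / 2) ^ (n + 1) := by ring
      linarith
  have h2 : ∀ n x, h n x ≤ 2 := fun n x => (h2' n x).trans (by
    have : (0 : ℝ) ≤ (1 / 2) ^ n := by positivity
    linarith)
  have hbdd : ∀ {g : X → ℝ}, Measurable g → (∀ x, 0 ≤ g x) → (∀ x, g x ≤ 2) → Integrable g μ :=
    fun hg hg0 hg2 => Integrable.of_bound hg.aestronglyMeasurable 2
      (Eventually.of_forall fun x => by
        rw [Real.norm_eq_abs, abs_of_nonneg (hg0 x)]; exact hg2 x)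
  have hhi : ∀ n, Integrable (h n) μ := fun n => hbdd (hm n) (h0 n) (h2 n)
  have hrec : ∀ n, ∫ x, h (n + 1) x ∂μ ≤ ∫ x, h n x ∂μ -
      (∫ x, h n x ∂μ) * μ.real (E n) / 2 + (1 / 2) ^ (n + 1) := fun n => by
    have h3 := hκ n (h n) (hm n) (h0 n) (h2 n)
    have h4 : Integrable (fun x => h n x * φ n (T^[κ n (h n)] x)) μ :=
      hbdd ((hm n).mul ((hφm n).comp (hT.measurable.iterate _)))
        (fun x => mul_nonneg (h0 n x) (hφ0 _ _))
        (fun x => (mul_le_of_le_one_right (h0 n x) (hφ1 _ _)).trans (h2 n x))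
    have h5 : ∫ x, h (n + 1) x ∂μ = ∫ x, h n x ∂μ -
        ∫ x, h n x * φ n (T^[κ n (h n)] x) ∂μ + (1 / 2) ^ (n + 1) := by
      have h6 : ∀ x, h (n + 1) x =
          (h n x - h n x * φ n (T^[κ n (h n)] x)) + (1 / 2) ^ (n + 1) := fun x => by
        rw [hsucc]
        ring
      simp only [h6]
      have h7 : Integrable (fun x => h n x - h n x * φ n (T^[κ n (h n)] x)) μ := (hhi n).sub h4
      rw [integral_add h7 (integrable_const _), integral_sub (hhi n) h4]
      simp
    linarith
  have hb : Summable fun n : ℕ => ((1 : ℝ) / 2) ^ (n + 1) :=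
    (summable_nat_add_iff 1).2 summable_geometric_two
  have he : ¬ Summable fun n => μ.real (E n) := fun hs => by
    refine hs.tsum_ofReal_ne_top ?_
    rw [← hsum]
    exact tsum_congr fun n => ENNReal.ofReal_toReal (measure_ne_top _ _)
  refine ⟨fun n => κ n (h n), ?_⟩
  -- Points missed from time `m` on keep weight at least `(1 / 2) ^ m`, whereas the integral of `h
  -- n` becomes arbitrarily small.
  have hZ : ∀ m, μ {x | ∀ n ≥ m, T^[κ n (h n)] x ∉ E n} = 0 := fun m => by
    have hge : ∀ n ≥ m, ∀ x ∈ {x | ∀ n ≥ m, T^[κ n (h n)] x ∉ E n}, (1 / 2 : ℝ) ^ m ≤ h n x := by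
      intro n hn x hx
      induction n, hn using Nat.le_induction with
      | base =>
        cases m with
        | zero => norm_num [h]
        | succ m =>
          rw [hsucc]
          exact le_add_of_nonneg_left (mul_nonneg (h0 m x) (sub_nonneg.2 (hφ1 _ _)))
      | succ n hn ih =>
        rw [hsucc]
        have h3 : φ n (T^[κ n (h n)] x) = 0 := indicator_of_notMem (hx n hn) _
        rw [h3, sub_zero, mul_one]
        exact ih.trans (le_add_of_nonneg_right (by positivity))
    by_contra hne
    have hZm : MeasurableSet {x | ∀ n ≥ m, T^[κ n (h n)] x ∉ E n} := by
      have : {x | ∀ n ≥ m, T^[κ n (h n)] x ∉ E n} =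
          ⋂ n, ⋂ (_ : n ≥ m), (T^[κ n (h n)] ⁻¹' E n)ᶜ := by ext; simp
      rw [this]
      exact MeasurableSet.iInter fun n => MeasurableSet.iInter fun _ =>
        (hT.measurable.iterate _ (hE n)).compl
    set Z := {x | ∀ n ≥ m, T^[κ n (h n)] x ∉ E n} with hZdef
    have hZ0 : 0 < μ.real Z := ENNReal.toReal_pos hne (measure_ne_top _ _)
    obtain ⟨n, hn, hlt⟩ := exists_lt_of_recursive_le
      (fun n => integral_nonneg (h0 n)) (fun n => measureReal_nonneg) hb he
      (fun n => by positivity) hrec (η := (1 / 2) ^ m * μ.real Z) (by positivity) m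
    have h3 : (1 / 2 : ℝ) ^ m * μ.real Z ≤ ∫ x, h n x ∂μ := by
      calc (1 / 2 : ℝ) ^ m * μ.real Z = ∫ x, Z.indicator (fun _ => (1 / 2 : ℝ) ^ m) x ∂μ := by
            rw [integral_indicator_const _ hZm, smul_eq_mul, mul_comm]
        _ ≤ ∫ x, h n x ∂μ := by
            refine integral_mono ((integrable_const _).indicator hZm) (hhi n) fun x => ?_
            by_cases hx : x ∈ Z
            · rw [indicator_of_mem hx]
              exact hge n hn x hx
            · rw [indicator_of_notMem hx]
              exact h0 n x
    linarith
  have hall : ∀ᵐ x ∂μ, ∀ m, ¬ ∀ n ≥ m, T^[κ n (h n)] x ∉ E n :=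
    ae_all_iff.2 fun m => measure_eq_zero_iff_ae_notMem.1 (hZ m)
  filter_upwards [hall] with x hx
  refine frequently_atTop.2 fun m => ?_
  have := hx m
  push Not at this
  exact this

end Hitting

/-! ### Generic behaviour of the averages and the main theorem -/

namespace MPMap

variable {X : Type*} [MeasurableSpace X] {μ : Measure X}

theorem iter_natCast (T : MPMap μ) (k : ℕ) : T.iter k = T^[k] := by
  rw [iter, zpow_natCast, Equiv.Perm.coe_pow]
  rfl

/-- The sum in `movingAverage` starts at the exponent `v + 1`, which accounts for the shift `k - 1`.
-/
theorem movingAverage_eq_birkhoffAverage {𝕜 : Type*} [RCLike 𝕜] (T : MPMap μ) (k L : ℕ)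
    (f : X → 𝕜) (x : X) :
    T.movingAverage ((k : ℤ) - 1) L f x = birkhoffAverage ℝ T f L (T^[k] x) := by
  rw [birkhoffAverage_congr_ring ℝ 𝕜, movingAverage, birkhoffAverage, birkhoffSum, smul_eq_mul,
    one_div, sub_add_cancel]
  congr 1
  refine (Finset.sum_bij (fun (i : ℕ) _ => (k : ℤ) + i) ?_ ?_ ?_ ?_).symm
  · intro i hi
    have := Finset.mem_range.1 hi
    rw [Finset.mem_Icc]
    omega
  · intro i _ j _ hij
    simpa using hij
  · intro l hl
    have := Finset.mem_Icc.1 hl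
    exact ⟨(l - k).toNat, Finset.mem_range.2 (by omega), by omega⟩
  · intro i _
    rw [← Function.iterate_add_apply, add_comm i k, ← iter_natCast, Nat.cast_add]

/-- The exceptional null set is taken over all integer powers at once, so it serves every `v` and
`L`. This permits passing to a strongly measurable representative. -/
theorem ae_movingAverage_congr {𝕜 : Type*} [RCLike 𝕜] (T : MPMap μ) {f g : X → 𝕜} (hfg : f =ᵐ[μ] g) :
    ∀ᵐ x ∂μ, ∀ v L, T.movingAverage v L f x = T.movingAverage v L g x := by
  have h1 : ∀ k : ℤ, ∀ᵐ x ∂μ, f (T.iter k x) = g (T.iter k x) := fun k => by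
    refine Measure.QuasiMeasurePreserving.ae (μb := μ) ?_ hfg
    rcases k.eq_nat_or_neg with ⟨n, rfl | rfl⟩
    · rw [iter_natCast]
      exact (T.measurePreserving.iterate n).quasiMeasurePreserving
    · have : T.iter (-(n : ℤ)) = T.inv^[n] := by
        rw [iter, zpow_neg, zpow_natCast, ← inv_pow, Equiv.Perm.coe_pow]
        rfl
      rw [this]
      exact (T.inv.measurePreserving.iterate n).quasiMeasurePreserving
  filter_upwards [ae_all_iff.2 h1] with x hx v L
  simp only [movingAverage, hx]

/-- The natural powers of an invertible measure-preserving map. -/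
def npow (T : MPMap μ) : ℕ → MPMap μ
  | 0 => ⟨MeasurableEquiv.refl X, MeasurePreserving.id μ⟩
  | k + 1 => ⟨T.1.trans (npow T k).1, (npow T k).2.comp T.2⟩

theorem coe_npow (T : MPMap μ) (k : ℕ) : (T.npow k : X → X) = T^[k] := by
  induction k with
  | zero => rfl
  | succ k ih =>
    rw [Function.iterate_succ, ← ih]
    rfl

theorem continuous_npow (k : ℕ) : Continuous fun T : MPMap μ => T.npow k := by
  refine continuous_iff_continuousAt.2 fun T => ?_
  induction k with
  | zero => exact continuousAt_const
  | succ k ih =>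
    refine tendsto_nhds_iff.2 fun A hA => ?_
    have h1 := tendsto_nhds_iff.1 ih A hA
    have h2 := (tendsto_nhds_iff (l := 𝓝 T) (S := id) (T := T)).1 tendsto_id _
      ((T.npow k).measurable hA)
    refine tendsto_of_tendsto_of_tendsto_of_le_of_le tendsto_const_nhds
      (by simpa using h1.add h2) (fun _ => zero_le) fun S => ?_
    have h3 : μ (S ⁻¹' ((S.npow k ⁻¹' A) ∆ (T.npow k ⁻¹' A))) =
        μ ((S.npow k ⁻¹' A) ∆ (T.npow k ⁻¹' A)) := S.measurePreserving.measure_preimage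
      (((S.npow k).measurable hA).symmDiff ((T.npow k).measurable hA)).nullMeasurableSet
    refine (measure_symmDiff_le _ (S ⁻¹' (T.npow k ⁻¹' A)) _).trans ?_
    refine add_le_add ?_ le_rfl
    rw [← h3]
    exact le_of_eq rfl

section Continuity

variable [IsFiniteMeasure μ] {E : Type*} [NormedAddCommGroup E] [NormedSpace ℝ E]

theorem tendsto_lintegral_enorm_birkhoffAverage_sub (T : MPMap μ) {g : X → E}
    (hg : Integrable g μ) (L : ℕ) :
    Tendsto (fun S : MPMap μ =>
      ∫⁻ x, ‖birkhoffAverage ℝ S g L x - birkhoffAverage ℝ T g L x‖ₑ ∂μ) (𝓝 T) (𝓝 0) := by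
  have h1 : ∀ k, Tendsto (fun S : MPMap μ => ∫⁻ x, ‖g (S^[k] x) - g (T^[k] x)‖ₑ ∂μ)
      (𝓝 T) (𝓝 0) := fun k => by
    have := ((T.npow k).tendsto_lintegral_enorm_comp_sub_nhds hg).comp
      ((continuous_npow k).tendsto T)
    simpa only [Function.comp_def, coe_npow] using this
  have h2 : Tendsto (fun S : MPMap μ => ‖(L : ℝ)⁻¹‖ₑ *
      ∑ k ∈ Finset.range L, ∫⁻ x, ‖g (S^[k] x) - g (T^[k] x)‖ₑ ∂μ) (𝓝 T) (𝓝 0) := by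
    have := ENNReal.Tendsto.const_mul (a := ‖(L : ℝ)⁻¹‖ₑ)
      (tendsto_finsetSum (Finset.range L) fun k _ => h1 k) (Or.inr enorm_ne_top)
    simpa using this
  refine tendsto_of_tendsto_of_tendsto_of_le_of_le tendsto_const_nhds h2 (fun _ => zero_le)
    fun S => ?_
  have hm : ∀ k, AEMeasurable (fun x => ‖g (S^[k] x) - g (T^[k] x)‖ₑ) μ := fun k =>
    ((hg.aestronglyMeasurable.comp_measurePreserving (S.measurePreserving.iterate k)).sub
      (hg.aestronglyMeasurable.comp_measurePreserving (T.measurePreserving.iterate k))).enorm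
  rw [← lintegral_finsetSum' _ fun k _ => hm k, ← lintegral_const_mul' _ _ enorm_ne_top]
  refine lintegral_mono fun x => ?_
  simp only [birkhoffAverage, birkhoffSum, ← smul_sub, ← Finset.sum_sub_distrib, enorm_smul]
  gcongr
  exact enorm_sum_le _ _

/-- Having a small ergodic average in `L¹` is an open condition. -/
theorem isOpen_setOf_exists_birkhoffAverage_lt {g : X → E} (hg : Integrable g μ) (ε : ℝ≥0∞) :
    IsOpen {T : MPMap μ | ∃ N, 0 < N ∧ ∫⁻ x, ‖birkhoffAverage ℝ T g N x‖ₑ ∂μ < ε} := by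
  refine isOpen_iff_mem_nhds.2 ?_
  rintro T ⟨N, hN, hT⟩
  have h1 := (T.tendsto_lintegral_enorm_birkhoffAverage_sub hg N).eventually_lt_const
    (tsub_pos_of_lt hT)
  filter_upwards [h1] with S hS
  refine ⟨N, hN, ?_⟩
  have hm := (aestronglyMeasurable_birkhoffAverage S.measurePreserving hg.aestronglyMeasurable N).sub
    (aestronglyMeasurable_birkhoffAverage T.measurePreserving hg.aestronglyMeasurable N)
  calc ∫⁻ x, ‖birkhoffAverage ℝ S g N x‖ₑ ∂μ
      = ∫⁻ x, ‖(birkhoffAverage ℝ S g N - birkhoffAverage ℝ T g N) x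
          + birkhoffAverage ℝ T g N x‖ₑ ∂μ := by simp
    _ ≤ _ := lintegral_enorm_add_le hm
    _ < ε := lt_tsub_iff_right.1 hS

/-- The measure of the set where an ergodic average is large is lower semicontinuous. -/
theorem lowerSemicontinuous_measure_lt_norm_birkhoffAverage {g : X → E} (hg : Integrable g μ)
    (L : ℕ) (δ : ℝ) :
    LowerSemicontinuous fun T : MPMap μ => μ {x | δ < ‖birkhoffAverage ℝ T g L x‖} := by
  intro T c hc
  -- Raising the threshold by `1 / (n + 1)` leaves room for a perturbation small in `L¹`, by
  -- Markov's inequality. By continuity from below, some `B n` still has measure above `c`.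
  let B : ℕ → Set X := fun n => {x | δ + 1 / ((n : ℝ) + 1) < ‖birkhoffAverage ℝ T g L x‖}
  have hBmono : Monotone B := fun m n hmn x hx => by
    have h1 : δ + 1 / ((m : ℝ) + 1) < ‖birkhoffAverage ℝ T g L x‖ := hx
    have h2 := Nat.one_div_le_one_div (α := ℝ) hmn
    exact lt_of_le_of_lt (by linarith) h1
  have hBU : {x | δ < ‖birkhoffAverage ℝ T g L x‖} = ⋃ n, B n := by
    ext x
    simp only [mem_iUnion]
    constructor
    · intro hx
      have hx' : δ < ‖birkhoffAverage ℝ T g L x‖ := hx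
      obtain ⟨n, hn⟩ := exists_nat_one_div_lt (sub_pos.2 hx')
      exact ⟨n, show δ + 1 / ((n : ℝ) + 1) < _ by linarith⟩
    · rintro ⟨n, hn⟩
      have h1 : δ + 1 / ((n : ℝ) + 1) < ‖birkhoffAverage ℝ T g L x‖ := hn
      have h2 : (0 : ℝ) < 1 / ((n : ℝ) + 1) := by positivity
      exact show δ < _ by linarith
  replace hc : c < μ {x | δ < ‖birkhoffAverage ℝ T g L x‖} := hc
  rw [hBU, hBmono.measure_iUnion] at hc
  obtain ⟨n, hn⟩ := lt_iSup_iff.1 hc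
  set r : ℝ := 1 / ((n : ℝ) + 1) with hr
  have hr0 : 0 < r := by positivity
  have h1 : Tendsto (fun S : MPMap μ =>
      (∫⁻ x, ‖birkhoffAverage ℝ S g L x - birkhoffAverage ℝ T g L x‖ₑ ∂μ) / ENNReal.ofReal r)
      (𝓝 T) (𝓝 0) := by
    have := ENNReal.Tendsto.div_const (T.tendsto_lintegral_enorm_birkhoffAverage_sub hg L)
      (b := ENNReal.ofReal r) (Or.inr (by simpa using hr0))
    simpa using this
  filter_upwards [h1.eventually_lt_const (tsub_pos_of_lt hn)] with S hS
  have hm := ((aestronglyMeasurable_birkhoffAverage S.measurePreserving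
    hg.aestronglyMeasurable L).sub (aestronglyMeasurable_birkhoffAverage T.measurePreserving
      hg.aestronglyMeasurable L)).enorm
  have hmarkov := meas_ge_le_lintegral_div hm (ε := ENNReal.ofReal r) (by simpa using hr0)
    ENNReal.ofReal_ne_top
  have hsub : B n ⊆ {x | δ < ‖birkhoffAverage ℝ S g L x‖} ∪
      {x | ENNReal.ofReal r ≤ ‖(birkhoffAverage ℝ S g L - birkhoffAverage ℝ T g L) x‖ₑ} := by
    intro x hx
    have hx' : δ + r < ‖birkhoffAverage ℝ T g L x‖ := hx
    by_cases h2 : δ < ‖birkhoffAverage ℝ S g L x‖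
    · exact Or.inl h2
    · right
      change ENNReal.ofReal r ≤ ‖birkhoffAverage ℝ S g L x - birkhoffAverage ℝ T g L x‖ₑ
      rw [← ofReal_norm]
      refine ENNReal.ofReal_le_ofReal ?_
      have h3 := norm_sub_norm_le (birkhoffAverage ℝ T g L x) (birkhoffAverage ℝ S g L x)
      rw [norm_sub_rev] at h3
      linarith [not_lt.1 h2]
  have h4 : μ (B n) ≤ μ {x | δ < ‖birkhoffAverage ℝ S g L x‖} +
      (∫⁻ x, ‖birkhoffAverage ℝ S g L x - birkhoffAverage ℝ T g L x‖ₑ ∂μ) / ENNReal.ofReal r :=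
    (measure_mono hsub).trans ((measure_union_le _ _).trans (add_le_add le_rfl hmarkov))
  by_contra hcon
  have h5 := lt_tsub_iff_left.1 hS
  have h6 : μ (B n) ≤ c +
      (∫⁻ x, ‖birkhoffAverage ℝ S g L x - birkhoffAverage ℝ T g L x‖ₑ ∂μ) / ENNReal.ofReal r :=
    h4.trans (add_le_add (not_lt.1 hcon) le_rfl)
  exact absurd h5 (not_lt.2 h6)

end Continuity

variable [StandardBorelSpace X] [IsProbabilityMeasure μ] [NullSingletonClass μ]
  {𝕜 : Type*} [RCLike 𝕜]

/-- Generically the large values of the ergodic averages of a nonzero function have divergent total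
measure. -/
theorem exists_isGδ_dense_tsum_eq_top {f : X → 𝕜} (hfm : StronglyMeasurable f)
    (hf : Integrable f μ) (hf_ne : ¬ f =ᵐ[μ] 0) {L : ℕ → ℕ} (hL : ∀ n, 0 < L n) :
    ∃ δ : ℝ, 0 < δ ∧ ∃ B : Set (MPMap μ), IsGδ B ∧ Dense B ∧
      ∀ T ∈ B, ∑' n, μ {x | δ < ‖birkhoffAverage ℝ T f (L n) x‖} = ∞ := by
  obtain ⟨δ, hδ, hδf⟩ : ∃ δ : ℝ, 0 < δ ∧ μ {x | δ < ‖f x‖} ≠ 0 := by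
    by_contra! hcon
    refine hf_ne ?_
    have h1 : ∀ᵐ x ∂μ, ∀ n : ℕ, ¬ (1 / ((n : ℝ) + 1) < ‖f x‖) :=
      ae_all_iff.2 fun n => measure_eq_zero_iff_ae_notMem.1 (hcon _ (by positivity))
    filter_upwards [h1] with x hx
    by_contra hne
    obtain ⟨n, hn⟩ := exists_nat_one_div_lt (norm_pos_iff.2 hne)
    exact hx n hn
  have hC : MeasurableSet {x | δ < ‖f x‖} :=
    measurableSet_lt measurable_const hfm.norm.measurable
  let φ : MPMap μ → ℝ≥0∞ := fun T => ∑' n, μ {x | δ < ‖birkhoffAverage ℝ T f (L n) x‖}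
  have hφ : LowerSemicontinuous φ := lowerSemicontinuous_tsum fun n =>
    lowerSemicontinuous_measure_lt_norm_birkhoffAverage hf (L n) δ
  -- An infinite sum means exceeding every natural `K`. Each such condition is open by lower
  -- semicontinuity, for which the strict inequality `δ < ‖·‖` is used, and dense because it
  -- contains `{φ = ∞}`.
  have hopen : ∀ K : ℕ, IsOpen (φ ⁻¹' Ioi (K : ℝ≥0∞)) := fun K => hφ.isOpen_preimage K
  have hdense : Dense {T : MPMap μ | φ T = ∞} := by
    refine (dense_setOf_exists_fixed hC hδf).mono ?_
    rintro T ⟨E, hE, hμE, hfix⟩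
    have h2 : ∀ n, μ E ≤ μ {x | δ < ‖birkhoffAverage ℝ T f (L n) x‖} := fun n =>
      measure_mono fun x hx => by
        have h3 := Function.IsFixedPt.birkhoffAverage_eq (R := ℝ) (hfix x hx) f (n := L n)
          (by exact_mod_cast (hL n).ne')
        change δ < ‖birkhoffAverage ℝ T f (L n) x‖
        rw [h3]
        exact hE hx
    change φ T = ∞
    rw [eq_top_iff, ← ENNReal.tsum_const_eq_top_of_ne_zero (α := ℕ) hμE]
    exact ENNReal.tsum_le_tsum h2
  refine ⟨δ, hδ, ⋂ K : ℕ, φ ⁻¹' Ioi (K : ℝ≥0∞), .iInter_of_isOpen hopen,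
    dense_iInter_of_isOpen hopen fun K => hdense.mono fun T hT => ?_, fun T hT => ?_⟩
  · have hT' : φ T = ∞ := hT
    change (K : ℝ≥0∞) < φ T
    rw [hT']
    exact ENNReal.natCast_lt_top K
  · refine ENNReal.eq_top_of_forall_nnreal_le fun r => ?_
    obtain ⟨K, hK⟩ := exists_nat_ge r
    have h3 : (K : ℝ≥0∞) < φ T := mem_iInter.1 hT K
    refine le_trans ?_ h3.le
    exact_mod_cast hK

/-- Generically the ergodic averages of all integrable functions converge to their means. -/
theorem exists_isGδ_dense_averageVanish (μ : Measure X) [IsProbabilityMeasure μ]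
    [NullSingletonClass μ] :
    ∃ B : Set (MPMap μ), IsGδ B ∧ Dense B ∧ ∀ T ∈ B,
      (∀ g : X → ℝ, Integrable g μ → AverageVanish T μ fun x => g x - ∫ y, g y ∂μ) ∧
      ∀ g : X → 𝕜, Integrable g μ → AverageVanish T μ fun x => g x - ∫ y, g y ∂μ := by
  -- Separability reduces the claim to countably many sets, and `averageVanish_of_exists` reduces
  -- convergence to the existence of one small average for each tolerance.
  have := isSeparable_of_sigmaFinite μ
  obtain ⟨𝒜, h𝒜c, h𝒜⟩ := exists_countable_measureDense μ
  let u : Set X → X → ℝ := fun A x => A.indicator (fun _ => (1 : ℝ)) x - μ.real A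
  have hui : ∀ A ∈ 𝒜, Integrable (u A) μ := fun A hA =>
    ((integrable_const 1).indicator (h𝒜.measurable A hA)).sub (integrable_const _)
  let V : Set X → ℕ → Set (MPMap μ) := fun A k =>
    {T | ∃ N, 0 < N ∧ ∫⁻ x, ‖birkhoffAverage ℝ T (u A) N x‖ₑ ∂μ < ((k : ℝ≥0∞) + 1)⁻¹}
  have hVo : ∀ A ∈ 𝒜, ∀ k, IsOpen (V A k) := fun A hA k =>
    isOpen_setOf_exists_birkhoffAverage_lt (hui A hA) _
  have hVd : ∀ A ∈ 𝒜, ∀ k, Dense (V A k) := fun A hA k => by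
    -- Half the tolerance turns the weak inequality of the density lemma into the strict one that
    -- defines `V`.
    have hε : (0 : ℝ) < 1 / (2 * ((k : ℝ) + 1)) := by positivity
    refine (dense_setOf_exists_birkhoffAverage_close (h𝒜.measurable A hA) hε).mono ?_
    rintro T ⟨N, hN, hT⟩
    refine ⟨N, hN, ?_⟩
    simp only [u, birkhoffAverage_sub_const _ hN]
    refine hT.trans_lt ?_
    have h1 : ((k : ℝ≥0∞) + 1)⁻¹ = ENNReal.ofReal (((k : ℝ) + 1)⁻¹) := by
      rw [ENNReal.ofReal_inv_of_pos (by positivity), ENNReal.ofReal_add (by positivity) zero_le_one]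
      simp
    rw [h1]
    refine (ENNReal.ofReal_lt_ofReal_iff (by positivity)).2 ?_
    rw [one_div]
    refine inv_strictAnti₀ (by positivity) ?_
    have : (0 : ℝ) ≤ k := by positivity
    linarith
  refine ⟨⋂ A ∈ 𝒜, ⋂ k, V A k, ?_, ?_, fun T hT => ?_⟩
  · exact IsGδ.biInter h𝒜c fun A hA => .iInter_of_isOpen (hVo A hA)
  · exact dense_biInter_of_Gδ (fun A hA => .iInter_of_isOpen (hVo A hA)) h𝒜c
      fun A hA => dense_iInter_of_isOpen (hVo A hA) (hVd A hA)
  · have h2 : ∀ A ∈ 𝒜, AverageVanish T μ (u A) := fun A hA => by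
      refine averageVanish_of_exists T.measurePreserving (hui A hA) fun ε hε => ?_
      obtain ⟨k, hk⟩ := ENNReal.exists_inv_nat_lt hε.ne'
      obtain ⟨N, hN, hlt⟩ := mem_iInter.1 (mem_iInter₂.1 hT A hA) k
      exact ⟨N, hN, hlt.le.trans ((ENNReal.inv_le_inv.2 le_self_add).trans hk.le)⟩
    exact ⟨fun g hg => averageVanish_sub_integral T.measurePreserving h𝒜 h2 hg,
      fun g hg => averageVanish_sub_integral T.measurePreserving h𝒜 h2 hg⟩

/-- The conclusion of the main theorem for a strongly measurable function. -/
theorem exists_movingAverage_diverge (μ : Measure X) [IsProbabilityMeasure μ]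
    [NullSingletonClass μ] {L : ℕ → ℕ} (hL_pos : ∀ n, 0 < L n) (hL : StrictMono L)
    {f : X → 𝕜} (hfm : StronglyMeasurable f) (hf : Integrable f μ) (hf_mean : ∫ x, f x ∂μ = 0)
    (hf_ne : ¬ f =ᵐ[μ] 0) :
    ∃ δ : ℝ, 0 < δ ∧ ∃ B : Set (MPMap μ), IsGδ B ∧ Dense B ∧
      ∀ T ∈ B, Ergodic T μ ∧
        ∑' n, μ {x | δ ≤ ‖T.movingAverage 0 (L n) f x‖} = ∞ ∧
        ∃ v : ℕ → ℤ,
          (∀ᵐ x ∂μ, ENNReal.ofReal δ ≤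
            limsup (fun n => ‖T.movingAverage (v n) (L n) f x‖ₑ) atTop) ∧
          (∀ᵐ x ∂μ, liminf (fun n => ‖T.movingAverage (v n) (L n) f x‖ₑ) atTop = 0) := by
  obtain ⟨δ, hδ, B₁, hB₁, hB₁d, hsum⟩ := exists_isGδ_dense_tsum_eq_top hfm hf hf_ne hL_pos
  obtain ⟨B₂, hB₂, hB₂d, hav⟩ := exists_isGδ_dense_averageVanish (𝕜 := 𝕜) μ
  refine ⟨δ, hδ, B₁ ∩ B₂, hB₁.inter hB₂, hB₁d.inter_of_Gδ hB₁ hB₂ hB₂d, fun T hT => ?_⟩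
  have hset : ∀ A, MeasurableSet A →
      AverageVanish T μ fun x => A.indicator (fun _ => (1 : ℝ)) x - μ.real A := fun A hA => by
    have := (hav T hT.2).1 (A.indicator fun _ => (1 : ℝ)) ((integrable_const 1).indicator hA)
    simpa only [integral_indicator_const _ hA, smul_eq_mul, mul_one] using this
  have hbm : ∀ n, StronglyMeasurable (birkhoffAverage ℝ T f (L n)) := fun n => by
    have : StronglyMeasurable fun x => ∑ k ∈ Finset.range (L n), f (T^[k] x) :=
      Finset.stronglyMeasurable_fun_sum _ fun k _ =>
        hfm.comp_measurable (T.measurable.iterate k)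
    exact this.const_smul _
  let E : ℕ → Set X := fun n => {x | δ ≤ ‖birkhoffAverage ℝ T f (L n) x‖}
  have hE : ∀ n, MeasurableSet (E n) := fun n =>
    measurableSet_le measurable_const (hbm n).norm.measurable
  have hEsum : ∑' n, μ (E n) = ∞ := by
    rw [eq_top_iff, ← hsum T hT.1]
    exact ENNReal.tsum_le_tsum fun n => measure_mono fun x hx =>
      show δ ≤ ‖birkhoffAverage ℝ T f (L n) x‖ from le_of_lt hx
  obtain ⟨k, hk⟩ := exists_iterates_frequently_mem T.measurePreserving hset hE hEsum
  refine ⟨ergodic_of_averageVanish T.measurePreserving hset, ?_, fun n => (k n : ℤ) - 1, ?_, ?_⟩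
  · rw [← hEsum]
    refine tsum_congr fun n => ?_
    -- `M(0, L)` is the Birkhoff average composed with `T`, so its level sets are preimages of the
    -- sets `E n`.
    rw [← T.measurePreserving.measure_preimage (hE n).nullMeasurableSet]
    congr 1
    ext x
    have := T.movingAverage_eq_birkhoffAverage 1 (L n) f x
    simp only [Nat.cast_one, sub_self, Function.iterate_one] at this
    change δ ≤ ‖T.movingAverage 0 (L n) f x‖ ↔ δ ≤ ‖birkhoffAverage ℝ T f (L n) (T x)‖
    rw [this]
  · filter_upwards [hk] with x hx
    refine le_limsup_of_frequently_le (hx.mono fun n hn => ?_)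
    rw [movingAverage_eq_birkhoffAverage, ← ofReal_norm]
    exact ENNReal.ofReal_le_ofReal hn
  -- The `L¹` norms do not depend on the shifts `k n` and tend to zero because `L n → ∞`; Fatou's
  -- lemma concludes.
  · simp only [movingAverage_eq_birkhoffAverage]
    have hm : ∀ n, Measurable fun x => ‖birkhoffAverage ℝ T f (L n) (T^[k n] x)‖ₑ := fun n =>
      ((hbm n).comp_measurable (T.measurable.iterate (k n))).enorm
    have h0 : Tendsto (fun n => ∫⁻ x, ‖birkhoffAverage ℝ T f (L n) (T^[k n] x)‖ₑ ∂μ) atTop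
        (𝓝 0) := by
      have h1 := (hav T hT.2).2 f hf
      simp only [hf_mean, sub_zero] at h1
      refine (h1.comp hL.tendsto_atTop).congr fun n => ?_
      exact (lintegral_comp_iterate T.measurePreserving (hbm n).aestronglyMeasurable (k n)).symm
    have h2 : ∫⁻ x, liminf (fun n => ‖birkhoffAverage ℝ T f (L n) (T^[k n] x)‖ₑ) atTop ∂μ = 0 :=
      le_antisymm ((lintegral_liminf_le hm).trans h0.liminf_eq.le) zero_le
    rw [lintegral_eq_zero_iff (.liminf hm)] at h2
    exact h2

end MPMap

/-- Limsup and liminf are taken of `‖·‖ₑ` in `ℝ≥0∞`, where they exist without any boundedness. A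
finite limit would make both equal to its norm, contradicting `δ > 0`. -/
theorem mainTheorem8 {X : Type*} [MeasurableSpace X] [StandardBorelSpace X]
    (μ : Measure X) [IsProbabilityMeasure μ] [NullSingletonClass μ]
    {𝕜 : Type*} [RCLike 𝕜]
    (L : ℕ → ℕ) (hL_pos : ∀ n, 0 < L n) (hL : StrictMono L)
    (f : X → 𝕜) (hf : Integrable f μ) (hf_mean : ∫ x, f x ∂μ = 0) (hf_ne : ¬ f =ᵐ[μ] 0) :
    ∃ δ : ℝ, 0 < δ ∧ ∃ B : Set (MPMap μ), IsGδ B ∧ Dense B ∧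
      ∀ T ∈ B, Ergodic T μ ∧
        ∑' n, μ {x | δ ≤ ‖T.movingAverage 0 (L n) f x‖} = ∞ ∧
        ∃ v : ℕ → ℤ,
          (∀ᵐ x ∂μ, ENNReal.ofReal δ ≤
            limsup (fun n => ‖T.movingAverage (v n) (L n) f x‖ₑ) atTop) ∧
          (∀ᵐ x ∂μ, liminf (fun n => ‖T.movingAverage (v n) (L n) f x‖ₑ) atTop = 0) ∧
          (∀ᵐ x ∂μ, ¬ ∃ c : 𝕜,
            Tendsto (fun n => T.movingAverage (v n) (L n) f x) atTop (𝓝 c)) := by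
  obtain ⟨g, hgm, hfg⟩ := hf.aestronglyMeasurable
  obtain ⟨δ, hδ, B, hB, hBd, hBT⟩ := MPMap.exists_movingAverage_diverge μ hL_pos hL hgm
    (hf.congr hfg) ((integral_congr_ae hfg).symm.trans hf_mean) fun h => hf_ne (hfg.trans h)
  refine ⟨δ, hδ, B, hB, hBd, fun T hT => ?_⟩
  obtain ⟨herg, hsum, v, hsup, hinf⟩ := hBT T hT
  have hcongr := T.ae_movingAverage_congr hfg
  have hsup' : ∀ᵐ x ∂μ, ENNReal.ofReal δ ≤
      limsup (fun n => ‖T.movingAverage (v n) (L n) f x‖ₑ) atTop := by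
    filter_upwards [hsup, hcongr] with x hx hc
    simpa only [hc] using hx
  have hinf' : ∀ᵐ x ∂μ, liminf (fun n => ‖T.movingAverage (v n) (L n) f x‖ₑ) atTop = 0 := by
    filter_upwards [hinf, hcongr] with x hx hc
    simpa only [hc] using hx
  refine ⟨herg, ?_, v, hsup', hinf', ?_⟩
  · rw [← hsum]
    refine tsum_congr fun n => measure_congr ?_
    filter_upwards [hcongr] with x hc
    exact propext (by change δ ≤ ‖_‖ ↔ δ ≤ ‖_‖; rw [hc])
  · filter_upwards [hsup', hinf'] with x h1 h2
    rintro ⟨c, hc⟩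
    have h3 := hc.enorm
    rw [h3.limsup_eq, ← h3.liminf_eq, h2] at h1
    exact absurd h1 (by simpa using hδ)
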